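/- Let $A$ be a $C^*$-algebra (not necessarily unital) and let $\alpha$ be a $*$-automorphism of $A$. A representation of a $C^*$-algebra on a Hilbert space $H$ is a $*$-homomorphism into $B(H)$. It is nondegenerate if the vectors $\pi(a)h$ span a dense subspace of $H$, and irreducible if $0$ and $H$ are the only closed invariant subspaces. A $C^*$-algebra is primitive if it has a faithful nonzero irreducible representation. A partial-isometric representation of $\mathbb{N}=\{0,1,2,\dots\}$ is a map $n\mapsto V_n$ into partial isometries with $V_{n+m}=V_nV_m$ for all $n,m$. A covariant partial-isometric representation of $(A,\alpha)$ on $H$ is a pair $(\pi,V)$ of a nondegenerate representation $\pi:A\to B(H)$ and a partial-isometric representation $V:\mathbb{N}\to B(H)$ such that $\pi(\alpha^n(a))=V_n\pi(a)V_n^*$ and $V_n^*V_n\pi(a)=\pi(a)V_n^*V_n$ for all $a\in A$, $n\in\mathbb{N}$. The partial-isometric crossed product $A\times_\alpha^{\mathrm{piso}}\mathbb{N}$ is a triple $(B,j,v)$ (it exists and is unique up to isomorphism) consisting of a $C^*$-algebra $B$, a nondegenerate homomorphism $j:A\to B$ and a partial-isometric representation $v:\mathbb{N}\to M(B)$ such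 that $(j,v)$ satisfies the two covariance relations in $M(B)$; for every covariant partial-isometric representation $(\pi,V)$ on a Hilbert space $H$ there is a nondegenerate representation $\pi\times V:B\to B(H)$ with $(\pi\times V)\circ j=\pi$ and $\overline{\pi\times V}\circ v=V$, where $\overline{\pi\times V}$ is the canonical extension to $M(B)$; and $B$ is the closed linear span of $\{v_n^*j(a)v_m : n,m\in\mathbb{N},\ a\in A\}$. **Theorem.** The partial-isometric crossed product $A\times_\alpha^{\mathrm{piso}}\mathbb{N}$ is primitive if and only if $A$ is primitive. Moreover, let $\pi$ be a faithful nonzero irreducible representation of $A$ on a Hilbert space $H$, and on $\ell^2(\mathbb{N},H)$ put $(\Pi(a)\xi)(n)=\pi(\alpha^n(a))\xi(n)$ and $(V_m\xi)(n)=\xi(n+m)$ for $a\in A$ and $n,m\in\mathbb{N}$. Then the representation $\Pi\times V$ of $A\times_\alpha^{\mathrm{piso}}\mathbb{N}$ on $\ell^2(\mathbb{N},H)$ exists, is irreducible and is faithful. -/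

import Mathlib

open scoped MultiplierAlgebra ENNReal

universe u

namespace Piso

section Representations

variable {A H : Type*} [NonUnitalCStarAlgebra A] [NormedAddCommGroup H] [InnerProductSpace ℂ H]
  [CompleteSpace H]

/-- A representation `π : A → B(H)` is nondegenerate if the vectors `π(a)h` span a dense subspace
of `H`. -/
def IsNondegenerateRep (π : A →⋆ₙₐ[ℂ] (H →L[ℂ] H)) : Prop :=
  (Submodule.span ℂ {x : H | ∃ (a : A) (h : H), x = π a h}).topologicalClosure = ⊤

/-- A representation `π : A → B(H)` is irreducible if the only closed subspaces of `H` which are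
invariant under `π(A)` are `0` and `H`. -/
def IsIrreducibleRep (π : A →⋆ₙₐ[ℂ] (H →L[ℂ] H)) : Prop :=
  ∀ K : Submodule ℂ H, IsClosed (K : Set H) → (∀ a : A, ∀ x ∈ K, π a x ∈ K) → K = ⊥ ∨ K = ⊤

end Representations

/-- A C*-algebra is primitive if it has a faithful nonzero irreducible representation on some
Hilbert space. -/
def IsPrimitive (A : Type u) [NonUnitalCStarAlgebra A] : Prop :=
  ∃ (H : Type u) (_ : NormedAddCommGroup H) (_ : InnerProductSpace ℂ H) (_ : CompleteSpace H)
    (π : A →⋆ₙₐ[ℂ] (H →L[ℂ] H)), π ≠ 0 ∧ Function.Injective π ∧ IsIrreducibleRep π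

/-- A partial-isometric representation of the additive semigroup `ℕ` in a C*-algebra `M`
(below, `M` is `B(H)` or a multiplier algebra). The identity `V V* V = V` says that `V` is a
partial isometry. -/
structure IsPartialIsometricRep {M : Type*} [Mul M] [Star M] (V : ℕ → M) : Prop where
  partial_isometry : ∀ n, V n * star (V n) * V n = V n
  map_add : ∀ n m, V (n + m) = V n * V m

section Covariance

variable {A : Type*} [NonUnitalCStarAlgebra A]

/-- A covariant partial-isometric representation of `(A, α)` on a Hilbert space `H`. -/
structure IsCovariantRep {H : Type*} [NormedAddCommGroup H] [InnerProductSpace ℂ H]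
    [CompleteSpace H] (α : A ≃⋆ₐ[ℂ] A) (π : A →⋆ₙₐ[ℂ] (H →L[ℂ] H)) (V : ℕ → (H →L[ℂ] H)) :
    Prop where
  nondegenerate : IsNondegenerateRep π
  isRep : IsPartialIsometricRep V
  covariant : ∀ n a, π (α^[n] a) = V n * π a * star (V n)
  commute : ∀ n a, star (V n) * V n * π a = π a * (star (V n) * V n)

/-- A representation `ρ` of `B` on `H` is an integrated form `π × V` of the pair `(π, V)`, relative
to `j : A → B` and `v : ℕ → M(B)`: it is nondegenerate, `ρ ∘ j = π`, and the canonical extension of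
`ρ` to `M(B)`, which is determined by `ρ(m) ρ(b) = ρ(m b)` for `m ∈ M(B)` and `b ∈ B`, carries `v`
to `V`. (Here `(v n).fst b` is the product `v n * b`, an element of `B`.) -/
structure IsIntegratedForm {B H : Type*} [NonUnitalCStarAlgebra B] [NormedAddCommGroup H]
    [InnerProductSpace ℂ H] [CompleteSpace H] (j : A →⋆ₙₐ[ℂ] B) (v : ℕ → 𝓜(ℂ, B))
    (π : A →⋆ₙₐ[ℂ] (H →L[ℂ] H)) (V : ℕ → (H →L[ℂ] H)) (ρ : B →⋆ₙₐ[ℂ] (H →L[ℂ] H)) : Prop where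
  nondegenerate : IsNondegenerateRep ρ
  comp_left : ∀ a, ρ (j a) = π a
  comp_right : ∀ n b, V n * ρ b = ρ ((v n).fst b)

end Covariance

/-- `(B, j, v)` is a partial-isometric crossed product of the system `(A, α)`: `j` is a
nondegenerate homomorphism into `B`, `v` is a partial-isometric representation in `M(B)`, the pair
is covariant, every covariant representation of `(A, α)` on a Hilbert space integrates to a
nondegenerate representation of `B`, and `B` is the closed linear span of the elements
`v_n* j(a) v_m`. -/
structure IsPisoCrossedProduct {A : Type u} [NonUnitalCStarAlgebra A] (α : A ≃⋆ₐ[ℂ] A)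
    {B : Type u} [NonUnitalCStarAlgebra B] (j : A →⋆ₙₐ[ℂ] B) (v : ℕ → 𝓜(ℂ, B)) : Prop where
  nondegenerate :
    (Submodule.span ℂ {x : B | ∃ (a : A) (b : B), x = j a * b}).topologicalClosure = ⊤
  isRep : IsPartialIsometricRep v
  covariant : ∀ n a, (j (α^[n] a) : 𝓜(ℂ, B)) = v n * (j a : 𝓜(ℂ, B)) * star (v n)
  commute : ∀ n a, star (v n) * v n * (j a : 𝓜(ℂ, B)) = (j a : 𝓜(ℂ, B)) * (star (v n) * v n)
  universal : ∀ (H : Type u) [NormedAddCommGroup H] [InnerProductSpace ℂ H] [CompleteSpace H]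
    (π : A →⋆ₙₐ[ℂ] (H →L[ℂ] H)) (V : ℕ → (H →L[ℂ] H)), IsCovariantRep α π V →
      ∃ ρ : B →⋆ₙₐ[ℂ] (H →L[ℂ] H), IsIntegratedForm j v π V ρ
  dense : (Submodule.span ℂ {x : B | ∃ (n m : ℕ) (a : A),
    (x : 𝓜(ℂ, B)) = star (v n) * (j a : 𝓜(ℂ, B)) * v m}).topologicalClosure = ⊤

section Standard

variable {A H : Type*} [NonUnitalCStarAlgebra A] [NormedAddCommGroup H] [InnerProductSpace ℂ H]

theorem summable_shift (m : ℕ) (T : ℕ → (H →L[ℂ] H)) (C : ℝ) (hT : ∀ n, ‖T n‖ ≤ C)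
    (ξ : lp (fun _ : ℕ => H) 2) :
    Summable (fun n => ‖T n (ξ (n + m))‖ ^ (2 : ℝ≥0∞).toReal) ∧
    ∑' n, ‖T n (ξ (n + m))‖ ^ (2 : ℝ≥0∞).toReal ≤ (C * ‖ξ‖) ^ (2 : ℝ≥0∞).toReal := by
  have h2 : (0 : ℝ) < (2 : ℝ≥0∞).toReal := by norm_num
  have hC : 0 ≤ C := (norm_nonneg _).trans (hT 0)
  have hs := lp.memℓp ξ
  rw [memℓp_gen_iff h2] at hs
  have hle : ∀ n, ‖T n (ξ (n + m))‖ ^ (2 : ℝ≥0∞).toReal ≤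
      C ^ (2 : ℝ≥0∞).toReal * ‖ξ (n + m)‖ ^ (2 : ℝ≥0∞).toReal := fun n => by
    rw [← Real.mul_rpow hC (norm_nonneg _)]
    exact Real.rpow_le_rpow (norm_nonneg _) ((T n).le_of_opNorm_le (hT n) _) h2.le
  have hs' := ((summable_nat_add_iff m).2 hs).mul_left (C ^ (2 : ℝ≥0∞).toReal)
  have hsum := Summable.of_nonneg_of_le (fun n => by positivity) hle hs'
  refine ⟨hsum, (hsum.tsum_le_tsum hle hs').trans ?_⟩
  rw [Real.mul_rpow hC (norm_nonneg _), lp.norm_rpow_eq_tsum h2 ξ, tsum_mul_left]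
  refine mul_le_mul_of_nonneg_left ?_ (by positivity)
  rw [← hs.sum_add_tsum_nat_add m]
  exact le_add_of_nonneg_left (Finset.sum_nonneg fun i _ => by positivity)

/-- The operator on `ℓ²(ℕ, H)` given by `(S ξ)(n) = T n (ξ (n + m))`, where the operators `T n` on
`H` are bounded by `C`. -/
noncomputable def weightedShift (m : ℕ) (T : ℕ → (H →L[ℂ] H)) (C : ℝ)
    (hT : ∀ n, ‖T n‖ ≤ C) : lp (fun _ : ℕ => H) 2 →L[ℂ] lp (fun _ : ℕ => H) 2 :=
  LinearMap.mkContinuous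
    { toFun := fun ξ => ⟨fun n => T n (ξ (n + m)),
        memℓp_gen (summable_shift m T C hT ξ).1⟩
      map_add' := fun ξ η => Subtype.ext (funext fun n => map_add (T n) _ _)
      map_smul' := fun c ξ => Subtype.ext (funext fun n => map_smul (T n) _ _) }
    C (fun ξ => lp.norm_le_of_tsum_le (by norm_num)
      (mul_nonneg ((norm_nonneg _).trans (hT 0)) (norm_nonneg _)) (summable_shift m T C hT ξ).2)

@[simp] theorem weightedShift_apply (m : ℕ) (T : ℕ → (H →L[ℂ] H)) (C : ℝ)
    (hT : ∀ n, ‖T n‖ ≤ C) (ξ : lp (fun _ : ℕ => H) 2) (n : ℕ) :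
    weightedShift m T C hT ξ n = T n (ξ (n + m)) := rfl

/-- The operators `V m` on `ℓ²(ℕ, H)` given by `(V m ξ)(n) = ξ (n + m)`. -/
noncomputable def shiftRep (H : Type*) [NormedAddCommGroup H] [InnerProductSpace ℂ H]
    (m : ℕ) : lp (fun _ : ℕ => H) 2 →L[ℂ] lp (fun _ : ℕ => H) 2 :=
  weightedShift m (fun _ => ContinuousLinearMap.id ℂ H) 1
    (fun _ => ContinuousLinearMap.norm_id_le)

@[simp] theorem shiftRep_apply (m : ℕ) (ξ : lp (fun _ : ℕ => H) 2) (n : ℕ) :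
    shiftRep H m ξ n = ξ (n + m) := rfl

variable [CompleteSpace H]

theorem norm_iterate_le (α : A ≃⋆ₐ[ℂ] A) (π : A →⋆ₙₐ[ℂ] (H →L[ℂ] H)) (a : A) (n : ℕ) :
    ‖π (α^[n] a)‖ ≤ ‖a‖ := by
  refine (NonUnitalStarAlgHom.norm_apply_le π _).trans ?_
  induction n with
  | zero => exact le_rfl
  | succ k ih =>
    rw [Function.iterate_succ_apply']
    exact (NonUnitalStarAlgHom.norm_apply_le α _).trans ih

/-- The representation `Π` of `A` on `ℓ²(ℕ, H)` given by `(Π(a) ξ)(n) = π(αⁿ(a)) (ξ n)`. -/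
noncomputable def diagRep (α : A ≃⋆ₐ[ℂ] A) (π : A →⋆ₙₐ[ℂ] (H →L[ℂ] H)) :
    A →⋆ₙₐ[ℂ] (lp (fun _ : ℕ => H) 2 →L[ℂ] lp (fun _ : ℕ => H) 2) where
  toFun a := weightedShift 0 (fun n => π (α^[n] a)) ‖a‖ (norm_iterate_le α π a)
  map_smul' c a := by
    ext ξ n
    have : α^[n] (c • a) = c • α^[n] a := by
      induction n with
      | zero => rfl
      | succ k ih => rw [Function.iterate_succ_apply', ih, map_smul, Function.iterate_succ_apply']
    simp [this]
  map_zero' := by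
    ext ξ n
    simp [iterate_map_zero]
  map_add' a b := by
    ext ξ n
    simp [iterate_map_add]
  map_mul' a b := by
    ext ξ n
    simp [iterate_map_mul]
  map_star' a := by
    refine (ContinuousLinearMap.eq_adjoint_iff _ _).2 fun ξ η => ?_
    rw [lp.inner_eq_tsum, lp.inner_eq_tsum]
    refine tsum_congr fun n => ?_
    have : α^[n] (star a) = star (α^[n] a) := by
      induction n with
      | zero => rfl
      | succ k ih => rw [Function.iterate_succ_apply', ih, map_star, Function.iterate_succ_apply']
    simp [this, map_star, ContinuousLinearMap.star_eq_adjoint,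
      ContinuousLinearMap.adjoint_inner_left]

@[simp] theorem diagRep_apply (α : A ≃⋆ₐ[ℂ] A) (π : A →⋆ₙₐ[ℂ] (H →L[ℂ] H)) (a : A)
    (ξ : lp (fun _ : ℕ => H) 2) (n : ℕ) : diagRep α π a ξ n = π (α^[n] a) (ξ n) := rfl

end Standard


/- The rest of this part proves that the object characterized by `IsPisoCrossedProduct` exists for
every system: it is a subalgebra of the direct sum of all covariant representations. -/

section Existence

theorem exists_transfer {B C : Type*} [NonUnitalCStarAlgebra C] (e : B ≃ C) :
    ∃ (_ : NonUnitalCStarAlgebra B) (f : B →⋆ₙₐ[ℂ] C), Function.Bijective f := by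
  let i1 : NonUnitalRing B := e.nonUnitalRing
  let φ : B ≃+* C := e.ringEquiv
  let i2 : NonUnitalNormedRing B :=
    NonUnitalNormedRing.induced _ C φ.toNonUnitalRingHom φ.injective
  let i3 : StarRing B :=
    { star := fun b => φ.symm (star (φ b))
      star_involutive := fun b => by
        change φ.symm (star (φ (φ.symm (star (φ b))))) = b
        simp
      star_mul := fun a b => by
        simp
      star_add := fun a b => by
        simp }
  have hstar : ∀ b, φ (star b) = star (φ b) := fun b => φ.apply_symm_apply _
  have hiso : Isometry φ := Isometry.of_dist_eq fun _ _ => rfl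
  have hnorm : ∀ b, ‖b‖ = ‖φ b‖ := fun _ => rfl
  let i4 : Module ℂ B := e.module ℂ
  have hsmul : ∀ (c : ℂ) b, φ (c • b) = c • φ b := fun c b => e.apply_symm_apply _
  have hns : ∀ (c : ℂ) b, ‖φ (c • b)‖ ≤ ‖c‖ * ‖φ b‖ := fun c b => by
    rw [hsmul]
    exact norm_smul_le _ _
  let i5 : NormedSpace ℂ B :=
    { i4 with norm_smul_le := hns }
  let i6 : NonUnitalCStarAlgebra B :=
    { i2, i3, i5 with
      complete := fun {f} hf => (hiso.isUniformInducing.completeSpace_congr φ.surjective).2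
        inferInstance |>.complete hf
      norm_mul_self_le := fun b => by
        rw [hnorm, hnorm, map_mul, hstar]
        exact CStarRing.norm_mul_self_le _
      smul_assoc := fun c a b => φ.injective (by
        simp only [smul_eq_mul, hsmul, map_mul, smul_mul_assoc])
      smul_comm := fun c a b => φ.injective (by
        simp only [smul_eq_mul, hsmul, map_mul, mul_smul_comm])
      star_smul := fun c a => φ.injective (by
        simp only [hsmul, hstar, star_smul]) }
  exact ⟨i6,
    { toFun := φ, map_smul' := hsmul, map_zero' := map_zero φ, map_add' := map_add φ,
      map_mul' := map_mul φ, map_star' := hstar }, φ.bijective⟩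

section Words

variable {A P : Type*} [NonUnitalCStarAlgebra A] [NonUnitalCStarAlgebra P]

/-- The relations that hold for a covariant partial-isometric representation. -/
structure Relations (α : A ≃⋆ₐ[ℂ] A) (j : A →⋆ₙₐ[ℂ] P) (v : ℕ → P) : Prop where
  zero_mul : ∀ x, v 0 * x = x
  mul_zero : ∀ x, x * v 0 = x
  add : ∀ n m, v (n + m) = v n * v m
  coiso : ∀ n, v n * star (v n) = v 0
  comm : ∀ n a, v n * j a = j (α^[n] a) * v n

theorem star_iterate (α : A ≃⋆ₐ[ℂ] A) (n : ℕ) (a : A) : α^[n] (star a) = star (α^[n] a) := by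
  induction n with
  | zero => rfl
  | succ k ih => rw [Function.iterate_succ_apply', ih, map_star, Function.iterate_succ_apply']

variable {α : A ≃⋆ₐ[ℂ] A} {j : A →⋆ₙₐ[ℂ] P} {v : ℕ → P}

theorem Relations.star_comm (h : Relations α j v) (n : ℕ) (a : A) :
    j a * star (v n) = star (v n) * j (α^[n] a) := by
  have := congrArg star (h.comm n (star a))
  simpa [star_mul, ← map_star, ← star_iterate] using this

/-- The words `v_n* j(a) v_m`. -/
def word (j : A →⋆ₙₐ[ℂ] P) (v : ℕ → P) (n : ℕ) (a : A) (m : ℕ) : P := star (v n) * j a * v m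

theorem Relations.mul_word (h : Relations α j v) (k n : ℕ) (a : A) (m : ℕ) :
    ∃ n' a' m', v k * word j v n a m = word j v n' a' m' := by
  have h0 : star (v 0) = v 0 := by
    have := h.zero_mul (star (v 0)); rw [h.coiso] at this; exact this.symm
  rcases le_total k n with hk | hk
  · obtain ⟨d, rfl⟩ := Nat.exists_eq_add_of_le' hk
    refine ⟨d, a, m, ?_⟩
    simp only [word, h.add, star_mul, ← mul_assoc, h.coiso, h.zero_mul]
  · obtain ⟨d, rfl⟩ := Nat.exists_eq_add_of_le' hk
    refine ⟨0, α^[d] a, d + m, ?_⟩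
    rw [word, word, h.add d n, h0, h.add d m]
    calc v d * v n * (star (v n) * j a * v m) = v d * (v n * star (v n) * (j a * v m)) := by
          simp only [mul_assoc]
      _ = v d * j a * v m := by rw [h.coiso, h.zero_mul, mul_assoc]
      _ = _ := by rw [h.comm, h.zero_mul]; simp only [mul_assoc]

theorem star_word (n : ℕ) (a : A) (m : ℕ) :
    star (word j v n a m) = word j v m (star a) n := by
  simp [word, map_star, mul_assoc]

theorem word_mul (h : Relations α j v) (k n : ℕ) (a : A) (m : ℕ) :
    word j v n a m * v k = word j v n a (m + k) := by
  simp [word, h.add, mul_assoc]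

theorem Relations.word_mul_star (h : Relations α j v) (k n : ℕ) (a : A) (m : ℕ) :
    ∃ n' a' m', word j v n a m * star (v k) = word j v n' a' m' := by
  obtain ⟨n', a', m', e⟩ := h.mul_word k m (star a) n
  refine ⟨m', star a', n', ?_⟩
  rw [← star_word, ← e, star_mul, star_word, star_star]

theorem Relations.word_mul_j (h : Relations α j v) (b : A) (n : ℕ) (a : A) (m : ℕ) :
    word j v n a m * j b = word j v n (a * α^[m] b) m := by
  simp only [word, mul_assoc, h.comm, map_mul]

theorem Relations.word_mul_word (h : Relations α j v) (n : ℕ) (a : A) (m k : ℕ) (b : A) (l : ℕ) :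
    ∃ n' a' m', word j v n a m * word j v k b l = word j v n' a' m' := by
  obtain ⟨n', a', m', e⟩ := h.word_mul_star k n a m
  refine ⟨n', a' * α^[m'] b, m' + l, ?_⟩
  rw [← word_mul h, ← h.word_mul_j, ← e]
  simp only [word, mul_assoc]

/-- The set of words. -/
def words (j : A →⋆ₙₐ[ℂ] P) (v : ℕ → P) : Set P := {x | ∃ n a m, x = word j v n a m}

/-- The C*-algebra generated by the words. -/
def wordAlg (h : Relations α j v) : NonUnitalStarSubalgebra ℂ P :=
  NonUnitalStarSubalgebra.topologicalClosure
    { Submodule.span ℂ (words j v) with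
      mul_mem' := fun {x y} hx hy => by
        change x * y ∈ Submodule.span ℂ (words j v)
        induction hx using Submodule.span_induction with
        | mem x hx =>
          obtain ⟨n, a, m, rfl⟩ := hx
          induction hy using Submodule.span_induction with
          | mem y hy =>
            obtain ⟨k, b, l, rfl⟩ := hy
            obtain ⟨n', a', m', e⟩ := h.word_mul_word n a m k b l
            exact Submodule.subset_span ⟨n', a', m', e⟩
          | zero => simp
          | add y z _ _ hy hz => rw [mul_add]; exact add_mem hy hz
          | smul c y _ hy => rw [mul_smul_comm]; exact Submodule.smul_mem _ c hy
        | zero => simp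
        | add y z _ _ hy hz => rw [add_mul]; exact add_mem hy hz
        | smul c y _ hy => rw [smul_mul_assoc]; exact Submodule.smul_mem _ c hy
      star_mem' := fun {x} hx => by
        change star x ∈ Submodule.span ℂ (words j v)
        change x ∈ Submodule.span ℂ (words j v) at hx
        induction hx using Submodule.span_induction with
        | mem x hx =>
          obtain ⟨n, a, m, rfl⟩ := hx
          exact Submodule.subset_span ⟨m, star a, n, star_word n a m⟩
        | zero => simp
        | add y z _ _ hy hz => rw [star_add]; exact add_mem hy hz
        | smul c y _ hy => rw [star_smul]; exact Submodule.smul_mem _ _ hy }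

theorem coe_wordAlg (h : Relations α j v) :
    (wordAlg h : Set P) = closure (Submodule.span ℂ (words j v) : Set P) := rfl

theorem wordAlg_induction (h : Relations α j v) {T : P → P} (hT : Continuous T)
    (hadd : ∀ x y, T (x + y) = T x + T y) (hsmul : ∀ (c : ℂ) x, T (c • x) = c • T x)
    (hw : ∀ n a m, ∃ n' a' m', T (word j v n a m) = word j v n' a' m') {x : P}
    (hx : x ∈ wordAlg h) : T x ∈ wordAlg h := by
  rw [← SetLike.mem_coe, coe_wordAlg] at hx ⊢
  refine map_mem_closure hT hx fun y hy => ?_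
  rw [SetLike.mem_coe] at hy ⊢
  induction hy using Submodule.span_induction with
  | mem x hx =>
    obtain ⟨n, a, m, rfl⟩ := hx
    obtain ⟨n', a', m', e⟩ := hw n a m
    exact Submodule.subset_span ⟨n', a', m', e⟩
  | zero =>
    have := hsmul 0 0
    rw [zero_smul, zero_smul] at this
    rw [this]; exact zero_mem _
  | add y z _ _ hy hz => rw [hadd]; exact add_mem hy hz
  | smul c y _ hy => rw [hsmul]; exact Submodule.smul_mem _ _ hy

theorem small_wordAlg {A : Type u} [NonUnitalCStarAlgebra A] {α : A ≃⋆ₐ[ℂ] A}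
    {j : A →⋆ₙₐ[ℂ] P} (h : Relations α j v) : Small.{u} (wordAlg h) := by
  classical
  let g : (ℕ × A × ℕ →₀ ℂ) → P := fun c => Finsupp.linearCombination ℂ
    (fun t : ℕ × A × ℕ => word j v t.1 t.2.1 t.2.2) c
  let F : (ℕ → (ℕ × A × ℕ →₀ ℂ)) → P := fun s => Filter.limUnder Filter.atTop (fun n => g (s n))
  have : (wordAlg h : Set P) ⊆ Set.range F := by
    intro x hx
    rw [coe_wordAlg, mem_closure_iff_seq_limit] at hx
    obtain ⟨y, hy, hlim⟩ := hx
    have hr : words j v = Set.range (fun t : ℕ × A × ℕ => word j v t.1 t.2.1 t.2.2) := by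
      ext z
      constructor
      · rintro ⟨n, a, m, rfl⟩; exact ⟨(n, a, m), rfl⟩
      · rintro ⟨⟨n, a, m⟩, rfl⟩; exact ⟨n, a, m, rfl⟩
    have : ∀ n, ∃ c, g c = y n := fun n => by
      have := hy n
      rw [hr, SetLike.mem_coe, ← Finsupp.range_linearCombination] at this
      exact this
    choose s hs using this
    refine ⟨s, ?_⟩
    have : (fun n => g (s n)) = y := funext hs
    simp only [F]
    rw [this]
    exact hlim.limUnder_eq
  exact small_subset this

end Words

section Multiplier

variable {A B P : Type*} [NonUnitalCStarAlgebra A] [NonUnitalCStarAlgebra B]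
  [NonUnitalCStarAlgebra P]

/-- An element of `P` which multiplies the image of `f` into itself gives a multiplier. -/
theorem exists_multiplier (f : B →⋆ₙₐ[ℂ] P) (hf : Function.Injective f) (x : P)
    (hl : ∀ b, ∃ c, f c = x * f b) (hr : ∀ b, ∃ c, f c = f b * x) :
    ∃ m : 𝓜(ℂ, B), (∀ b, f (m.fst b) = x * f b) ∧ ∀ b, f (m.snd b) = f b * x := by
  choose L hL using hl
  choose R hR using hr
  have hn : ∀ b, ‖f b‖ = ‖b‖ := fun b => NonUnitalStarAlgHom.norm_map f hf b
  refine ⟨{ fst := LinearMap.mkContinuous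
              { toFun := L
                map_add' := fun a b => hf (by simp [hL, mul_add])
                map_smul' := fun c b => hf (by simp [hL, mul_smul_comm, map_smul]) } ‖x‖
              (fun b => by
                change ‖L b‖ ≤ _
                rw [← hn, hL, ← hn b]; exact norm_mul_le _ _)
            snd := LinearMap.mkContinuous
              { toFun := R
                map_add' := fun a b => hf (by simp [hR, add_mul])
                map_smul' := fun c b => hf (by simp [hR, smul_mul_assoc, map_smul]) } ‖x‖
              (fun b => by
                change ‖R b‖ ≤ _
                rw [← hn, hR, ← hn b, mul_comm]; exact norm_mul_le _ _)
            central := fun a b => hf (by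
              change f (R a * b) = f (a * L b)
              rw [map_mul, map_mul, hL, hR, mul_assoc]) }, fun b => hL b, fun b => hR b⟩

theorem multiplier_ext (f : B →⋆ₙₐ[ℂ] P) (hf : Function.Injective f) {x y : 𝓜(ℂ, B)}
    (hl : ∀ b, f (x.fst b) = f (y.fst b)) (hr : ∀ b, f (x.snd b) = f (y.snd b)) : x = y :=
  DoubleCentralizer.ext _ _ _ _ (Prod.ext (ContinuousLinearMap.ext fun b => hf (hl b))
    (ContinuousLinearMap.ext fun b => hf (hr b)))

open Filter Topology in
theorem exists_mul_tendsto (a : A) : a ∈ closure {x : A | ∃ b c : A, x = b * c} := by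
  let _ := CStarAlgebra.spectralOrder A
  have := CStarAlgebra.spectralOrderedRing A
  have h := (CStarAlgebra.increasingApproximateUnit A).toIsApproximateUnit
  have := h.neBot
  exact mem_closure_of_tendsto (h.tendsto_mul_left a) (Eventually.of_forall fun e => ⟨_, _, rfl⟩)

end Multiplier

section Covariant

variable {A H : Type*} [NonUnitalCStarAlgebra A] [NormedAddCommGroup H] [InnerProductSpace ℂ H]
  [CompleteSpace H] {α : A ≃⋆ₐ[ℂ] A} {π : A →⋆ₙₐ[ℂ] (H →L[ℂ] H)} {V : ℕ → (H →L[ℂ] H)}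

theorem iterate_surjective (α : A ≃⋆ₐ[ℂ] A) (n : ℕ) : Function.Surjective (α^[n]) :=
  (EquivLike.surjective α).iterate n

theorem eq_one_of_nondegenerate (hπ : IsNondegenerateRep π) {T : H →L[ℂ] H}
    (h : ∀ a, T * π a = π a) : T = 1 := by
  refine ContinuousLinearMap.ext_on (s := {x : H | ∃ (a : A) (h : H), x = π a h}) ?_ ?_
  · rw [dense_iff_closure_eq, ← Submodule.topologicalClosure_coe, hπ]; rfl
  · rintro _ ⟨a, x, rfl⟩
    exact DFunLike.congr_fun (h a) x

theorem IsCovariantRep.coiso (h : IsCovariantRep α π V) (n : ℕ) : V n * star (V n) = 1 := by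
  refine eq_one_of_nondegenerate h.nondegenerate fun a => ?_
  obtain ⟨b, rfl⟩ := iterate_surjective α n a
  rw [h.covariant]
  simp only [← mul_assoc, h.isRep.partial_isometry]

theorem IsCovariantRep.zero (h : IsCovariantRep α π V) : V 0 = 1 := by
  have h1 := h.isRep.map_add 0 0
  have h2 := h.coiso 0
  calc V 0 = V 0 * (V 0 * star (V 0)) := by rw [h2, mul_one]
    _ = 1 := by rw [← mul_assoc, ← h1]; exact h2

theorem IsCovariantRep.relations (h : IsCovariantRep α π V) : Relations α π V where
  zero_mul x := by rw [h.zero, one_mul]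
  mul_zero x := by rw [h.zero, mul_one]
  add := h.isRep.map_add
  coiso n := by rw [h.coiso, h.zero]
  comm n a := by
    rw [h.covariant, mul_assoc (V n * π a), mul_assoc (V n), ← h.commute, ← mul_assoc,
      ← mul_assoc, h.coiso, one_mul]

theorem IsCovariantRep.norm_le (h : IsCovariantRep α π V) (n : ℕ) : ‖V n‖ ≤ 1 := by
  have h1 : ‖V n‖ * ‖V n‖ ≤ 1 := by
    rw [← CStarRing.norm_self_mul_star, h.coiso]
    exact ContinuousLinearMap.norm_id_le
  nlinarith [norm_nonneg (V n)]

end Covariant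

section Universal

/-- A covariant partial-isometric representation, bundled with its Hilbert space. -/
structure CovRep {A : Type u} [NonUnitalCStarAlgebra A] (α : A ≃⋆ₐ[ℂ] A) where
  H : Type u
  [i1 : NormedAddCommGroup H]
  [i2 : InnerProductSpace ℂ H]
  [i3 : CompleteSpace H]
  π : A →⋆ₙₐ[ℂ] (H →L[ℂ] H)
  V : ℕ → (H →L[ℂ] H)
  cov : IsCovariantRep α π V

attribute [instance] CovRep.i1 CovRep.i2 CovRep.i3

variable {A : Type u} [NonUnitalCStarAlgebra A] (α : A ≃⋆ₐ[ℂ] A)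

/-- The bounded families of operators on the spaces of all covariant representations. -/
abbrev BigAlg : Type (u + 1) := lp (fun i : CovRep α => i.H →L[ℂ] i.H) ∞

/-- The evaluation of a bounded family at a representation. -/
noncomputable def evalHom (i : CovRep α) : BigAlg α →⋆ₙₐ[ℂ] (i.H →L[ℂ] i.H) where
  toFun x := x i
  map_smul' _ _ := rfl
  map_zero' := rfl
  map_add' _ _ := rfl
  map_mul' _ _ := rfl
  map_star' _ := rfl

/-- The direct sum of the homomorphisms `π`. -/
noncomputable def bigHom : A →⋆ₙₐ[ℂ] BigAlg α where
  toFun a := ⟨fun i => i.π a, memℓp_infty ⟨‖a‖, by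
    rintro _ ⟨i, rfl⟩
    exact NonUnitalStarAlgHom.norm_apply_le i.π a⟩⟩
  map_smul' c a := Subtype.ext (funext fun i => map_smul i.π c a)
  map_zero' := Subtype.ext (funext fun i => map_zero i.π)
  map_add' a b := Subtype.ext (funext fun i => map_add i.π a b)
  map_mul' a b := Subtype.ext (funext fun i => map_mul i.π a b)
  map_star' a := Subtype.ext (funext fun i => map_star i.π a)

/-- The direct sum of the partial isometries. -/
noncomputable def bigV (n : ℕ) : BigAlg α :=
  ⟨fun i => i.V n, memℓp_infty ⟨1, by
    rintro _ ⟨i, rfl⟩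
    exact i.cov.norm_le n⟩⟩

theorem big_relations : Relations α (bigHom α) (bigV α) where
  zero_mul x := Subtype.ext (funext fun i => i.cov.relations.zero_mul (x i))
  mul_zero x := Subtype.ext (funext fun i => i.cov.relations.mul_zero (x i))
  add n m := Subtype.ext (funext fun i => i.cov.relations.add n m)
  coiso n := Subtype.ext (funext fun i => i.cov.relations.coiso n)
  comm n a := Subtype.ext (funext fun i => i.cov.relations.comm n a)

theorem exists_of_relations {P : Type*} [NonUnitalCStarAlgebra P] {bj : A →⋆ₙₐ[ℂ] P} {bv : ℕ → P}
    (h : Relations α bj bv)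
    (huniv : ∀ (H : Type u) [NormedAddCommGroup H] [InnerProductSpace ℂ H] [CompleteSpace H]
      (π : A →⋆ₙₐ[ℂ] (H →L[ℂ] H)) (V : ℕ → (H →L[ℂ] H)), IsCovariantRep α π V →
      ∃ e : P →⋆ₙₐ[ℂ] (H →L[ℂ] H), (∀ a, e (bj a) = π a) ∧ ∀ n, e (bv n) = V n) :
    ∃ (B : Type u) (_ : NonUnitalCStarAlgebra B) (j : A →⋆ₙₐ[ℂ] B) (v : ℕ → 𝓜(ℂ, B)),
      IsPisoCrossedProduct α j v := by
  have hW := small_wordAlg h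
  have : IsClosed (wordAlg h : Set (P)) :=
    NonUnitalStarSubalgebra.isClosed_topologicalClosure _
  obtain ⟨B, ⟨e⟩⟩ : ∃ B : Type u, Nonempty (B ≃ wordAlg h) := ⟨_, ⟨(equivShrink _).symm⟩⟩
  obtain ⟨iB, f₀, hf₀⟩ := exists_transfer e
  let f : B →⋆ₙₐ[ℂ] P :=
    (NonUnitalStarSubalgebraClass.subtype (wordAlg h)).comp f₀
  have hf : Function.Injective f := Subtype.val_injective.comp hf₀.1
  have hiso : Isometry f := NonUnitalStarAlgHom.isometry f hf
  have hmem : ∀ b, f b ∈ wordAlg h := fun b => (f₀ b).2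
  have hsurj : ∀ x ∈ wordAlg h, ∃ b, f b = x := fun x hx => by
    obtain ⟨b, hb⟩ := hf₀.2 ⟨x, hx⟩
    exact ⟨b, congrArg Subtype.val hb⟩
  have h0 : star (bv 0) = bv 0 := by
    have := h.zero_mul (star (bv 0)); rw [h.coiso] at this; exact this.symm
  have hword : ∀ n a m, word (bj) (bv) n a m ∈ wordAlg h := fun n a m =>
    subset_closure (Submodule.subset_span ⟨n, a, m, rfl⟩)
  have hj0 : ∀ a, word (bj) (bv) 0 a 0 = bj a := fun a => by
    rw [word, h0, h.zero_mul, h.mul_zero]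
  -- the homomorphism `j`
  have hj : ∀ a, ∃ b, f b = bj a := fun a => hsurj _ (hj0 a ▸ hword 0 a 0)
  choose j₀ hj₀ using hj
  let j : A →⋆ₙₐ[ℂ] B :=
    { toFun := j₀
      map_smul' := fun c a => hf (by simp [hj₀, map_smul])
      map_zero' := hf (by simp [hj₀])
      map_add' := fun a b => hf (by simp [hj₀])
      map_mul' := fun a b => hf (by simp [hj₀])
      map_star' := fun a => hf (by simp [hj₀, map_star]) }
  have hj : ∀ a, f (j a) = bj a := hj₀
  -- the multipliers `v`
  have hl : ∀ n x, x ∈ wordAlg h → bv n * x ∈ wordAlg h := fun n x hx =>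
    wordAlg_induction h (T := fun x => bv n * x) (by fun_prop) (mul_add _)
      (fun c x => mul_smul_comm c _ x) (fun k a m => h.mul_word n k a m) hx
  have hr : ∀ n x, x ∈ wordAlg h → x * bv n ∈ wordAlg h := fun n x hx =>
    wordAlg_induction h (T := fun x => x * bv n) (by fun_prop) (fun x y => add_mul x y _)
      (fun c x => smul_mul_assoc c x _) (fun k a m => ⟨k, a, m + n, word_mul h n k a m⟩) hx
  have hv : ∀ n, ∃ m : 𝓜(ℂ, B), (∀ b, f (m.fst b) = bv n * f b) ∧
      ∀ b, f (m.snd b) = f b * bv n := fun n =>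
    exists_multiplier f hf (bv n) (fun b => hsurj _ (hl n _ (hmem b)))
      (fun b => hsurj _ (hr n _ (hmem b)))
  choose v hvl hvr using hv
  have hsl : ∀ n b, f ((star (v n)).fst b) = star (bv n) * f b := fun n b => by
    rw [DoubleCentralizer.star_fst, map_star, hvr, map_star, star_mul, star_star]
  have hsr : ∀ n b, f ((star (v n)).snd b) = f b * star (bv n) := fun n b => by
    rw [DoubleCentralizer.star_snd, map_star, hvl, map_star, star_mul, star_star]
  have hjl : ∀ (a : B) b, f ((a : 𝓜(ℂ, B)).fst b) = f a * f b := fun a b => map_mul f a b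
  have hjr : ∀ (a : B) b, f ((a : 𝓜(ℂ, B)).snd b) = f b * f a := fun a b => map_mul f b a
  have hml : ∀ (x y : 𝓜(ℂ, B)) b, (x * y).fst b = x.fst (y.fst b) := fun _ _ _ => rfl
  have hmr : ∀ (x y : 𝓜(ℂ, B)) b, (x * y).snd b = y.snd (x.snd b) := fun _ _ _ => rfl
  have hcoe : ∀ n m a (x : B), f x = word (bj) (bv) n a m →
      (x : 𝓜(ℂ, B)) = star (v n) * (j a : 𝓜(ℂ, B)) * v m := fun n m a x hx => by
    refine multiplier_ext f hf (fun b => ?_) fun b => ?_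
    · simp only [hml, hjl, hsl, hvl, hj, hx, word, mul_assoc]
    · simp only [hmr, hjr, hsr, hvr, hj, hx, word, mul_assoc]
  have hvv : ∀ n x, bv n * (star (bv n) * x) = x := fun n x => by
    rw [← mul_assoc, h.coiso, h.zero_mul]
  have hdense : (Submodule.span ℂ {x : B | ∃ (n m : ℕ) (a : A),
      f x = word (bj) (bv) n a m}).topologicalClosure = ⊤ := by
    refine (Submodule.dense_iff_topologicalClosure_eq_top).1 fun b => ?_
    rw [hiso.isEmbedding.closure_eq_preimage_closure_image, Set.mem_preimage]
    refine closure_mono ?_ (show f b ∈ closure _ from hmem b)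
    intro y hy
    change y ∈ Submodule.span ℂ _ at hy
    induction hy using Submodule.span_induction with
    | mem y hy =>
      obtain ⟨n, a, m, rfl⟩ := hy
      obtain ⟨x, hx⟩ := hsurj _ (hword n a m)
      exact ⟨x, Submodule.subset_span ⟨n, m, a, hx⟩, hx⟩
    | zero => exact ⟨0, zero_mem _, map_zero f⟩
    | add y z _ _ hy hz =>
      obtain ⟨y', hy, rfl⟩ := hy
      obtain ⟨z', hz, rfl⟩ := hz
      exact ⟨y' + z', add_mem hy hz, map_add f _ _⟩
    | smul c y _ hy =>
      obtain ⟨y', hy, rfl⟩ := hy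
      exact ⟨c • y', Submodule.smul_mem _ c hy, map_smul f c _⟩
  refine ⟨B, iB, j, v, ?_, ⟨fun n => ?_, fun n m => ?_⟩, fun n a => ?_, fun n a => ?_, ?_, ?_⟩
  · -- nondegeneracy of `j`
    rw [eq_top_iff, ← hdense]
    refine Submodule.topologicalClosure_minimal _ (Submodule.span_le.2 ?_)
      (Submodule.isClosed_topologicalClosure _)
    rintro x ⟨n, m, a, hx⟩
    have hw : ∀ a, ∃ y : B, f y = word (bj) (bv) n a m := fun a => hsurj _ (hword n a m)
    choose w hw using hw
    have hwx : w a = x := hf ((hw a).trans hx.symm)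
    have hwc : Continuous w := by
      rw [hiso.isEmbedding.continuous_iff]
      have : f ∘ w = fun a => star (bv n) * bj a * bv m := funext hw
      rw [this]
      have hc : Continuous bj := AddMonoidHomClass.continuous_of_bound bj 1 fun a => by
        rw [one_mul]
        exact NonUnitalStarAlgHom.norm_apply_le bj a
      fun_prop
    rw [← hwx]
    have := map_mem_closure hwc (exists_mul_tendsto a)
      (t := {x : B | ∃ (a : A) (b : B), x = j a * b}) (by
        rintro _ ⟨b, c, rfl⟩
        obtain ⟨d, rfl⟩ := iterate_surjective α n b
        refine ⟨d, w c, hf ?_⟩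
        rw [map_mul, hj, hw, hw, word, word, map_mul]
        rw [← mul_assoc, ← mul_assoc, ← mul_assoc, ← h.star_comm])
    exact closure_mono Submodule.subset_span this
  · refine multiplier_ext f hf (fun b => ?_) fun b => ?_
    · simp only [hml, hvl, hsl, hvv]
    · simp only [hmr, hvr, hsr]
      simp only [mul_assoc, hvv]
  · refine multiplier_ext f hf (fun b => ?_) fun b => ?_
    · simp only [hml, hvl, h.add, mul_assoc]
    · simp only [hmr, hvr, h.add, mul_assoc]
  · refine multiplier_ext f hf (fun b => ?_) fun b => ?_
    · simp only [hml, hjl, hvl, hsl, hj]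
      rw [← mul_assoc (bj a), h.star_comm, mul_assoc, hvv]
    · simp only [hmr, hjr, hvr, hsr, hj]
      rw [mul_assoc (f b), h.comm, mul_assoc, mul_assoc, h.coiso, h.mul_zero]
  · refine multiplier_ext f hf (fun b => ?_) fun b => ?_
    · simp only [hml, hjl, hvl, hsl, hj]
      simp only [← mul_assoc]
      rw [mul_assoc (star (bv n)), h.comm, ← mul_assoc, h.star_comm]
    · simp only [hmr, hjr, hvr, hsr, hj]
      simp only [mul_assoc]
      rw [h.comm, ← mul_assoc (bj a), h.star_comm, mul_assoc]
  · intro H _ _ _ π V hV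
    obtain ⟨e, hej, hev⟩ := huniv H π V hV
    let ρ : B →⋆ₙₐ[ℂ] (H →L[ℂ] H) := e.comp f
    have hρj : ∀ a, ρ (j a) = π a := fun a => by
      change e (f (j a)) = _
      rw [hj, hej]
    refine ⟨ρ, ?_, hρj, fun n b => ?_⟩
    · rw [IsNondegenerateRep, eq_top_iff, ← hV.nondegenerate]
      refine Submodule.topologicalClosure_mono (Submodule.span_mono ?_)
      rintro _ ⟨a, x, rfl⟩
      exact ⟨j a, x, by rw [hρj]⟩
    · change _ = e (f _)
      rw [hvl, map_mul, hev]
      rfl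
  · rw [eq_top_iff, ← hdense]
    refine Submodule.topologicalClosure_mono (Submodule.span_mono ?_)
    rintro x ⟨n, m, a, hx⟩
    exact ⟨n, m, a, hcoe n m a x hx⟩


/-- Every system `(A, α)` has a partial-isometric crossed product. -/
theorem exists_isPisoCrossedProduct :
    ∃ (B : Type u) (_ : NonUnitalCStarAlgebra B) (j : A →⋆ₙₐ[ℂ] B) (v : ℕ → 𝓜(ℂ, B)),
      IsPisoCrossedProduct α j v :=
  exists_of_relations α (big_relations α) fun H _ _ _ π V hV =>
    ⟨evalHom α ⟨H, π, V, hV⟩, fun _ => rfl, fun _ => rfl⟩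

end Universal

end Existence

end Piso

/-! Write p_n = v_n* v_n and d = 1 - p_1. Since α is onto, covariance and nondegeneracy force v_n
v_n* = 1. So the p_n decrease, and the elements v_n* d v_n are mutually orthogonal projections whose
first N terms sum to 1 - p_N. The whole proof rests on the elements v_n* j(a) d v_m of B: under Π ×
V each acts on ℓ²(ℕ, H) as a matrix with the single entry π(a) in position (n, m)
(`IsIntegratedForm.cornerElt_apply`).

Irreducibility follows at once: from a vector with ξ(m) ≠ 0 these elements produce π(a)ξ(m) in every
position n, and ξ(m) is cyclic for π.

Faithfulness: let ρ = Π × V and ρ(b) = 0. Each corner d v_n b v_m* d is bounded by a matrix entry of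
ρ(b), because π is isometric, so it vanishes; hence (1 - p_N) b (1 - p_M) = 0 for all N, M. It
remains to see that b is not concentrated at infinity, i.e. that b v_m* tends to 0. This is where
amenability of ℤ would usually enter. Here it is a Følner-type estimate
(`IsMatrixOf.mul_norm_sq_le`): for x in the span of the words, M consecutive columns of its matrix
are compared with a truncation of size 2L + M, whose norm is at most ‖ρ(x)‖; as M grows the loss (2L
+ M)/M tends to 1. Letting M and then N tend to infinity gives b = 0.

Primitivity of A thus passes to B. Conversely a ↦ j(a)d embeds A in B as a hereditary subalgebra,
and an irreducible representation of B restricts to an irreducible one of it on its essential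
subspace. Injectivity of this embedding needs a nondegenerate representation of A that does not kill
a given element, which is the Gelfand–Naimark theorem. -/

namespace Piso

/-! ### Enough nondegenerate representations: states and the GNS construction. -/

section GelfandNaimark

open Unitization Filter Topology
open scoped ComplexOrder

/-- A contractive functional on a unital C*-algebra which maps `1` to `1` is real on self-adjoint
elements. -/
theorem im_eq_zero_of_isSelfAdjoint {U : Type*} [CStarAlgebra U] {g : StrongDual ℂ U}
    (hg : ‖g‖ ≤ 1) (h1 : g 1 = 1) {x : U} (hx : IsSelfAdjoint x) : (g x).im = 0 := by
  -- Compare |g(x + it)|² with ‖x + it‖² = ‖x² + t²‖. The left side contains a cross term linear in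
  -- t that the right side cannot match unless Im g(x) = 0.
  have key : ∀ t : ℝ, ((g x).im + t) ^ 2 ≤ ‖x‖ ^ 2 + t ^ 2 * ‖(1 : U)‖ := by
    intro t
    have e : star (x + (t * Complex.I : ℂ) • (1 : U)) * (x + (t * Complex.I : ℂ) • (1 : U)) =
        x * x + ((t ^ 2 : ℝ) : ℂ) • (1 : U) := by
      simp only [star_add, star_smul, hx.star_eq, star_one, add_mul, mul_add, smul_mul_assoc,
        mul_smul_comm, one_mul, mul_one]
      have : (starRingEnd ℂ) (t * Complex.I) = -(t * Complex.I) := by simp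
      simp only [RCLike.star_def, this, smul_add, smul_smul]
      have h3 : -(t * Complex.I) * (t * Complex.I) = ((t ^ 2 : ℝ) : ℂ) := by
        push_cast
        linear_combination (-(t : ℂ) ^ 2) * Complex.I_mul_I
      rw [mul_comm] at h3
      rw [h3]
      module
    have h2 : ‖g (x + (t * Complex.I : ℂ) • (1 : U))‖ ≤ ‖x + (t * Complex.I : ℂ) • (1 : U)‖ := by
      simpa using g.le_of_opNorm_le hg (x + (t * Complex.I : ℂ) • (1 : U))
    have h3 : ‖x + (t * Complex.I : ℂ) • (1 : U)‖ ^ 2 ≤ ‖x‖ ^ 2 + t ^ 2 * ‖(1 : U)‖ := by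
      rw [sq, ← CStarRing.norm_star_mul_self, e]
      refine (norm_add_le _ _).trans ?_
      rw [norm_smul, sq ‖x‖]
      gcongr
      · exact norm_mul_le _ _
      · simp
    have h4 : (g (x + (t * Complex.I : ℂ) • (1 : U))).im = (g x).im + t := by
      simp [h1]
    calc ((g x).im + t) ^ 2 ≤ ‖g (x + (t * Complex.I : ℂ) • (1 : U))‖ ^ 2 := by
          rw [← h4, ← sq_abs]
          gcongr
          exact Complex.abs_im_le_norm _
      _ ≤ _ := (pow_le_pow_left₀ (norm_nonneg _) h2 2).trans h3
  have hn : ‖(1 : U)‖ ≤ 1 := by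
    rcases subsingleton_or_nontrivial U with h | h
    · rw [Subsingleton.elim (1 : U) 0]; simp
    · simp
  by_contra hne
  -- This t makes the cross term 2t Im g(x) equal to ‖x‖² + 1, which exceeds the bound.
  have h2 := key ((‖x‖ ^ 2 + 1) / (2 * (g x).im))
  set t := (‖x‖ ^ 2 + 1) / (2 * (g x).im) with ht
  have h3 : 2 * (g x).im * t = ‖x‖ ^ 2 + 1 := by
    rw [ht]; field_simp
  nlinarith [sq_nonneg (g x).im, sq_nonneg t]

/-- A contractive functional on a unital C*-algebra which maps `1` to `1` is positive. -/
theorem nonneg_of_norm_le_one {U : Type*} [CStarAlgebra U] [PartialOrder U] [StarOrderedRing U]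
    {g : StrongDual ℂ U} (hg : ‖g‖ ≤ 1) (h1 : g 1 = 1) {x : U} (hx : 0 ≤ x) : 0 ≤ g x := by
  have hs : IsSelfAdjoint x := .of_nonneg hx
  refine Complex.nonneg_iff.2 ⟨?_, (im_eq_zero_of_isSelfAdjoint hg h1 hs).symm⟩
  -- As 0 ≤ ‖x‖ - x ≤ ‖x‖, contractivity puts ‖x‖ - g(x) within ‖x‖ of 0, so Re g(x) cannot be
  -- negative.
  have h2 : ‖algebraMap ℝ U ‖x‖ - x‖ ≤ ‖x‖ := by
    rw [CStarAlgebra.norm_le_iff_le_algebraMap _ (norm_nonneg _)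
      (sub_nonneg.2 (IsSelfAdjoint.le_algebraMap_norm_self hs))]
    exact sub_le_self _ hx
  have h3 : ‖g (algebraMap ℝ U ‖x‖ - x)‖ ≤ ‖x‖ := by
    refine (g.le_of_opNorm_le hg _).trans ?_
    rwa [one_mul]
  have h4 : g (algebraMap ℝ U ‖x‖) = ‖x‖ := by
    rw [Algebra.algebraMap_eq_smul_one, ← Complex.coe_smul, map_smul, h1, smul_eq_mul, mul_one]
  rw [map_sub, h4] at h3
  have := (Complex.abs_re_le_norm _).trans h3
  rw [abs_le] at this
  simp at this
  linarith [this.1, this.2]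

variable {A : Type u} [NonUnitalCStarAlgebra A]

/-- A positive functional which does not vanish at a given nonzero positive element. -/
theorem exists_positiveLinearMap_ne_zero [PartialOrder A] [StarOrderedRing A] {c : A}
    (hc : 0 ≤ c) (hc0 : c ≠ 0) : ∃ f : A →ₚ[ℂ] ℂ, f c ≠ 0 := by
  -- With this equality a contractive functional that norms 1 + c must attain its largest possible
  -- value at 1 and at c separately. It is therefore unital, hence positive, and equals ‖c‖ at c.
  have hnc : ‖(1 : Unitization ℂ A) + (c : Unitization ℂ A)‖ = 1 + ‖c‖ := by
    have hc' : 0 ≤ (c : Unitization ℂ A) := inr_nonneg_iff.2 hc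
    refine le_antisymm ?_ ?_
    · refine (norm_add_le _ _).trans ?_
      rw [norm_inr]
      simp
    · have h1 : IsSelfAdjoint ((1 : Unitization ℂ A) + (c : Unitization ℂ A)) :=
        (IsSelfAdjoint.one _).add (.of_nonneg hc')
      have h2 := IsSelfAdjoint.le_algebraMap_norm_self h1
      have h3 : (c : Unitization ℂ A) ≤ algebraMap ℝ _
          (‖(1 : Unitization ℂ A) + (c : Unitization ℂ A)‖ - 1) := by
        rw [map_sub, map_one, le_sub_iff_add_le, add_comm]
        exact h2
      have h0 : 0 ≤ ‖(1 : Unitization ℂ A) + (c : Unitization ℂ A)‖ - 1 := by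
        have := CStarAlgebra.norm_le_norm_of_nonneg_of_le (a := (1 : Unitization ℂ A))
          (by simp) (le_add_of_nonneg_right hc')
        rw [norm_one] at this
        linarith
      have := (CStarAlgebra.norm_le_iff_le_algebraMap _ h0 hc').2 h3
      rw [norm_inr] at this
      linarith
  obtain ⟨g, hg, hgc⟩ := exists_dual_vector'' ℂ ((1 : Unitization ℂ A) + (c : Unitization ℂ A))
  rw [hnc, map_add] at hgc
  have b1 : ‖g 1‖ ≤ 1 := by simpa using g.le_of_opNorm_le hg 1
  have b2 : ‖g (c : Unitization ℂ A)‖ ≤ ‖c‖ := by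
    simpa [norm_inr] using g.le_of_opNorm_le hg (c : Unitization ℂ A)
  have r1 := (Complex.re_le_norm _).trans b1
  have r2 := (Complex.re_le_norm _).trans b2
  have hre := congrArg Complex.re hgc
  simp at hre
  have e1 : (g 1).re = 1 := by linarith
  have e2 : (g (c : Unitization ℂ A)).re = ‖c‖ := by linarith
  have h1 : g 1 = 1 := by
    have h5 : ‖g 1‖ ^ 2 = (g 1).re * (g 1).re + (g 1).im * (g 1).im := by
      rw [← Complex.normSq_eq_norm_sq, Complex.normSq_apply]
    have h6 : (g 1).im = 0 := by
      have := pow_le_pow_left₀ (norm_nonneg _) b1 2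
      rw [h5, e1] at this
      nlinarith
    exact Complex.ext (by simp [e1]) (by simp [h6])
  refine ⟨PositiveLinearMap.mk₀ (g.toLinearMap ∘ₗ Unitization.inrHom ℂ ℂ A)
    fun x hx => nonneg_of_norm_le_one hg h1 (inr_nonneg_iff.2 hx), fun h => hc0 ?_⟩
  have h7 : g (c : Unitization ℂ A) = 0 := h
  rw [h7] at e2
  simpa using e2.symm

/-- Products bc are dense in A and the map from A to the GNS space is continuous, so the class of
any a is a limit of vectors π(b)[c]. -/
theorem gns_isNondegenerateRep [PartialOrder A] [StarOrderedRing A] (f : A →ₚ[ℂ] ℂ) :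
    IsNondegenerateRep f.gnsNonUnitalStarAlgHom := by
  obtain ⟨C, hC⟩ := f.exists_norm_apply_le
  let ι : A →L[ℂ] f.PreGNS := f.toPreGNS.toLinearMap.mkContinuous (√C) fun a => by
    change ‖f.toPreGNS a‖ ≤ _
    rw [PositiveLinearMap.preGNS_norm_def, PositiveLinearMap.ofPreGNS_toPreGNS,
      Real.sqrt_le_iff]
    refine ⟨by positivity, ?_⟩
    refine ((Complex.re_le_norm _).trans (hC _)).trans ?_
    rw [CStarRing.norm_star_mul_self, mul_pow, Real.sq_sqrt (by positivity), sq]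
  have hcont : Continuous fun a : A => ((ι a : f.PreGNS) : f.GNS) :=
    (UniformSpace.Completion.continuous_coe _).comp ι.continuous
  rw [IsNondegenerateRep, ← Submodule.dense_iff_topologicalClosure_eq_top]
  have key : ∀ a : A, ((ι a : f.PreGNS) : f.GNS) ∈
      closure {x : f.GNS | ∃ (a : A) (h : f.GNS), x = f.gnsNonUnitalStarAlgHom a h} := by
    intro a
    refine map_mem_closure (X := A) (Y := f.GNS) hcont (exists_mul_tendsto (A := A) a) ?_
    rintro _ ⟨b, c, rfl⟩
    refine ⟨b, ((ι c : f.PreGNS) : f.GNS), ?_⟩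
    rw [PositiveLinearMap.gnsNonUnitalStarAlgHom_apply_coe]
    rfl
  refine dense_closure.1 ((UniformSpace.Completion.denseRange_coe (α := f.PreGNS)).mono ?_)
  rintro _ ⟨a, rfl⟩
  exact closure_mono Submodule.subset_span (key (f.ofPreGNS a))

/-- Every nonzero element of a C*-algebra is nonzero in some nondegenerate representation. -/
theorem exists_isNondegenerateRep_ne_zero {a : A} (ha : a ≠ 0) :
    ∃ (H : Type u) (_ : NormedAddCommGroup H) (_ : InnerProductSpace ℂ H) (_ : CompleteSpace H)
      (π : A →⋆ₙₐ[ℂ] (H →L[ℂ] H)), IsNondegenerateRep π ∧ π a ≠ 0 := by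
  let _ := CStarAlgebra.spectralOrder A
  have := CStarAlgebra.spectralOrderedRing A
  -- The functional is chosen for the vector [a*]: π(a)[a*] = [aa*], whose squared norm is f of this
  -- element.
  have h1 : star (a * star a) * (a * star a) ≠ 0 := by
    rwa [Ne, CStarRing.star_mul_self_eq_zero_iff, CStarRing.mul_star_self_eq_zero_iff]
  obtain ⟨f, hf⟩ := exists_positiveLinearMap_ne_zero (star_mul_self_nonneg (a * star a)) h1
  refine ⟨f.GNS, inferInstance, inferInstance, inferInstance, f.gnsNonUnitalStarAlgHom,
    gns_isNondegenerateRep f, fun h => hf ?_⟩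
  have h2 := DFunLike.congr_fun h ((f.toPreGNS (star a) : f.PreGNS) : f.GNS)
  rw [PositiveLinearMap.gnsNonUnitalStarAlgHom_apply_coe] at h2
  have h3 : ‖f.toPreGNS (a * star a)‖ = 0 := by
    rw [← UniformSpace.Completion.norm_coe]
    exact norm_eq_zero.2 h2
  have h4 := f.preGNS_norm_sq (f.toPreGNS (a * star a))
  rw [h3] at h4
  simpa using h4.symm

end GelfandNaimark

/-! ### The covariant pair (Π, V) on ℓ²(ℕ, H). -/

section SquareSummable

variable {A H : Type*} [NonUnitalCStarAlgebra A] [NormedAddCommGroup H] [InnerProductSpace ℂ H]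
  [CompleteSpace H]

/-- The Hilbert space `ℓ²(ℕ, H)`. -/
abbrev SqSum (H : Type*) [NormedAddCommGroup H] : Type _ := lp (fun _ : ℕ => H) 2

/-- The embedding of `H` into `ℓ²(ℕ, H)` in position `n`. -/
noncomputable abbrev coordIncl (H : Type*) [NormedAddCommGroup H] [InnerProductSpace ℂ H] (n : ℕ) :
    H →L[ℂ] SqSum H := lp.singleContinuousLinearMap ℂ (fun _ : ℕ => H) 2 n

omit [CompleteSpace H] in
theorem coordIncl_apply (n : ℕ) (h : H) (m : ℕ) :
    coordIncl H n h m = if m = n then h else 0 := by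
  change (lp.single 2 n h : SqSum H) m = _
  rw [lp.single_apply, Pi.single_apply]

omit [CompleteSpace H] in
theorem inner_coordIncl_left (n : ℕ) (h : H) (ξ : SqSum H) :
    inner ℂ (coordIncl H n h) ξ = inner ℂ h (ξ n) :=
  lp.inner_single_left n h ξ

theorem star_shiftRep_apply (m : ℕ) (ξ : SqSum H) (n : ℕ) :
    star (shiftRep H m) ξ n = if m ≤ n then ξ (n - m) else 0 := by
  refine ext_inner_left ℂ fun h => ?_
  rw [← inner_coordIncl_left, ContinuousLinearMap.star_eq_adjoint,
    ContinuousLinearMap.adjoint_inner_right]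
  split_ifs with hm
  · rw [← inner_coordIncl_left]
    congr 1
    ext k
    rw [shiftRep_apply, coordIncl_apply, coordIncl_apply]
    exact if_congr (by omega) rfl rfl
  · rw [inner_zero_right, show shiftRep H m (coordIncl H n h) = 0 from ?_, inner_zero_left]
    ext k
    rw [shiftRep_apply, coordIncl_apply, if_neg (by omega)]
    rfl

omit [CompleteSpace H] in
theorem dense_span_coordIncl :
    Dense (Submodule.span ℂ {x : SqSum H | ∃ n h, x = coordIncl H n h} : Set (SqSum H)) := by
  intro ξ
  have h : HasSum (fun n => lp.single 2 n (ξ n) : ℕ → SqSum H) ξ :=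
    lp.hasSum_single (by simp) ξ
  refine mem_closure_of_tendsto h (Filter.Eventually.of_forall fun s => ?_)
  exact Submodule.sum_mem _ fun n _ => Submodule.subset_span ⟨n, ξ n, rfl⟩

omit [CompleteSpace H] in
theorem eq_top_of_coordIncl_mem {K : Submodule ℂ (SqSum H)} (hK : IsClosed (K : Set (SqSum H)))
    (h : ∀ n x, coordIncl H n x ∈ K) : K = ⊤ := by
  rw [eq_top_iff, ← (Submodule.dense_iff_topologicalClosure_eq_top).1 dense_span_coordIncl]
  refine Submodule.topologicalClosure_minimal _ (Submodule.span_le.2 ?_) hK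
  rintro _ ⟨n, x, rfl⟩
  exact h n x

variable (α : A ≃⋆ₐ[ℂ] A) {π : A →⋆ₙₐ[ℂ] (H →L[ℂ] H)}

/-- In position n, Π(b) acts as π(αⁿ(b)), and αⁿ is onto, so each position sees all of π(A). -/
theorem diagRep_isNondegenerateRep (hπ : IsNondegenerateRep π) :
    IsNondegenerateRep (diagRep α π) := by
  refine eq_top_of_coordIncl_mem (Submodule.isClosed_topologicalClosure _) fun n x => ?_
  have hx : x ∈ closure (Submodule.span ℂ {x : H | ∃ (a : A) (h : H), x = π a h} : Set H) := by
    rw [← Submodule.topologicalClosure_coe, hπ]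
    trivial
  refine map_mem_closure (coordIncl H n).continuous hx fun y hy => ?_
  have : Submodule.span ℂ {x : H | ∃ (a : A) (h : H), x = π a h} ≤
      (Submodule.span ℂ {x : SqSum H | ∃ a h, x = diagRep α π a h}).comap
        (coordIncl H n).toLinearMap := by
    refine Submodule.span_le.2 ?_
    rintro _ ⟨a, h, rfl⟩
    obtain ⟨b, rfl⟩ := iterate_surjective α n a
    refine Submodule.subset_span ⟨b, coordIncl H n h, ?_⟩
    ext k
    rw [diagRep_apply]
    erw [coordIncl_apply, coordIncl_apply]
    split_ifs with hk
    · rw [hk]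
    · rw [map_zero]
  exact this hy

theorem diagRep_isCovariantRep (hπ : IsNondegenerateRep π) :
    IsCovariantRep α (diagRep α π) (shiftRep H) where
  nondegenerate := diagRep_isNondegenerateRep α hπ
  isRep := by
    refine ⟨fun n => ?_, fun n m => ?_⟩
    · ext ξ k
      simp [star_shiftRep_apply]
    · ext ξ k
      simp [add_assoc]
  covariant n a := by
    ext ξ k
    simp [star_shiftRep_apply, Function.iterate_add_apply]
  commute n a := by
    ext ξ k
    by_cases h : n ≤ k <;> simp [star_shiftRep_apply, h]

end SquareSummable

/-! ### Cyclic vectors of irreducible representations. -/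

section Irreducible

variable {A H : Type*} [NonUnitalCStarAlgebra A] [NormedAddCommGroup H] [InnerProductSpace ℂ H]
  [CompleteSpace H] {π : A →⋆ₙₐ[ℂ] (H →L[ℂ] H)}

theorem IsIrreducibleRep.isNondegenerateRep (hπ : IsIrreducibleRep π) (h0 : π ≠ 0) :
    IsNondegenerateRep π := by
  refine (hπ _ (Submodule.isClosed_topologicalClosure _) fun a x _ => ?_).resolve_left fun h => ?_
  · exact subset_closure (Submodule.subset_span ⟨a, x, rfl⟩)
  · refine h0 (NonUnitalStarAlgHom.ext fun a => ContinuousLinearMap.ext fun x => ?_)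
    have : π a x ∈ (Submodule.span ℂ {x : H | ∃ (a : A) (h : H), x = π a h}).topologicalClosure :=
      subset_closure (Submodule.subset_span ⟨a, x, rfl⟩)
    rw [h] at this
    exact this

theorem IsNondegenerateRep.eq_zero (hπ : IsNondegenerateRep π) {x : H} (h : ∀ a, π a x = 0) :
    x = 0 := by
  have h1 : (Submodule.span ℂ {x : H | ∃ (a : A) (h : H), x = π a h}).topologicalClosure ≤
      (innerSL ℂ x).ker := by
    refine Submodule.topologicalClosure_minimal _ (Submodule.span_le.2 ?_)
      (ContinuousLinearMap.isClosed_ker _)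
    rintro _ ⟨a, y, rfl⟩
    change inner ℂ x (π a y) = 0
    rw [← ContinuousLinearMap.adjoint_inner_left, ← ContinuousLinearMap.star_eq_adjoint,
      ← map_star, h, inner_zero_left]
  rw [hπ] at h1
  exact inner_self_eq_zero.1 (h1 (show x ∈ ⊤ from trivial))

/-- In an irreducible representation every nonzero vector is cyclic. -/
theorem IsIrreducibleRep.eq_top_of_apply_mem (hπ : IsIrreducibleRep π) (h0 : π ≠ 0) {x : H}
    (hx : x ≠ 0) {K : Submodule ℂ H} (hK : IsClosed (K : Set H)) (h : ∀ a, π a x ∈ K) : K = ⊤ := by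
  let S : Submodule ℂ H := LinearMap.range
    ({ toFun := fun a => π a x, map_add' := fun a b => by simp, map_smul' := fun c a => by simp } :
      A →ₗ[ℂ] H)
  have hS : S.topologicalClosure = ⊤ := by
    refine (hπ _ (Submodule.isClosed_topologicalClosure _) fun a y hy => ?_).resolve_left
      fun h1 => hx ?_
    · refine map_mem_closure (π a).continuous hy ?_
      rintro _ ⟨b, rfl⟩
      exact ⟨a * b, by simp⟩
    · refine (hπ.isNondegenerateRep h0).eq_zero fun a => ?_
      have : π a x ∈ S.topologicalClosure := subset_closure ⟨a, rfl⟩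
      rw [h1] at this
      exact this
  rw [eq_top_iff, ← hS]
  refine Submodule.topologicalClosure_minimal _ ?_ hK
  rintro _ ⟨a, rfl⟩
  exact h a

end Irreducible

/-! ### Multipliers and their products with elements of the algebra. -/

section Multipliers

variable {B : Type*} [NonUnitalCStarAlgebra B]

theorem coe_multiplier_injective : Function.Injective ((↑) : B → 𝓜(ℂ, B)) := by
  refine (injective_iff_map_eq_zero (DoubleCentralizer.coeHom (𝕜 := ℂ) (A := B))).2 fun b h => ?_
  have : b * star b = 0 := congrArg (fun m : 𝓜(ℂ, B) => m.fst (star b)) h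
  rwa [CStarRing.mul_star_self_eq_zero_iff] at this

theorem eq_of_forall_mul_left_eq {x y : B} (h : ∀ c, c * x = c * y) : x = y := by
  have : star (x - y) * (x - y) = 0 := by rw [mul_sub, h, sub_self]
  rwa [CStarRing.star_mul_self_eq_zero_iff, sub_eq_zero] at this

theorem eq_of_forall_mul_right_eq {x y : B} (h : ∀ c, x * c = y * c) : x = y := by
  have : (x - y) * star (x - y) = 0 := by rw [sub_mul, h, sub_self]
  rwa [CStarRing.mul_star_self_eq_zero_iff, sub_eq_zero] at this

/-- The left action determines the right one: by centrality x.snd(b)c = b x.fst(c), and right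
multiplication by all c separates elements. -/
theorem multiplier_ext_fst {x y : 𝓜(ℂ, B)} (h : ∀ b, x.fst b = y.fst b) : x = y := by
  refine DoubleCentralizer.ext _ _ _ _ (Prod.ext (ContinuousLinearMap.ext h)
    (ContinuousLinearMap.ext fun b => eq_of_forall_mul_right_eq fun c => ?_))
  exact (x.central b c).trans ((congrArg (b * ·) (h c)).trans (y.central b c).symm)

theorem multiplier_fst_mul (m : 𝓜(ℂ, B)) (b c : B) : m.fst (b * c) = m.fst b * c :=
  eq_of_forall_mul_left_eq fun d => by
    rw [← m.central, ← mul_assoc, m.central, mul_assoc]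

theorem coe_fst_eq_mul (m : 𝓜(ℂ, B)) (b : B) : ((m.fst b : B) : 𝓜(ℂ, B)) = m * (b : 𝓜(ℂ, B)) :=
  multiplier_ext_fst fun c => (multiplier_fst_mul m b c).symm

theorem coe_snd_eq_mul (m : 𝓜(ℂ, B)) (b : B) : ((m.snd b : B) : 𝓜(ℂ, B)) = (b : 𝓜(ℂ, B)) * m :=
  multiplier_ext_fst fun c => m.central b c

end Multipliers

/-! ### Coisometry relations in M(B), words, and integrated forms on words. -/

section CrossedProduct

variable {A : Type u} [NonUnitalCStarAlgebra A] {α : A ≃⋆ₐ[ℂ] A} {B : Type u}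
  [NonUnitalCStarAlgebra B] {j : A →⋆ₙₐ[ℂ] B} {v : ℕ → 𝓜(ℂ, B)}

/-- The homomorphism `j` with values in the multiplier algebra. -/
noncomputable def multiplierHom (j : A →⋆ₙₐ[ℂ] B) : A →⋆ₙₐ[ℂ] 𝓜(ℂ, B) :=
  (DoubleCentralizer.coeHom (𝕜 := ℂ) (A := B)).comp j

theorem coe_hom (a : A) : (j a : 𝓜(ℂ, B)) = multiplierHom j a := rfl

/-- Every element of A is some αⁿ(b), and j(αⁿ(b)) = v_n j(b) v_n* absorbs v_n v_n* on the left;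
nondegeneracy of j then identifies this multiplier with 1. -/
theorem IsPisoCrossedProduct.mul_star (hB : IsPisoCrossedProduct α j v) (n : ℕ) :
    v n * star (v n) = 1 := by
  have h1 : ∀ a, v n * star (v n) * (j a : 𝓜(ℂ, B)) = j a := fun a => by
    obtain ⟨b, rfl⟩ := iterate_surjective α n a
    rw [hB.covariant]
    simp only [← mul_assoc, hB.isRep.partial_isometry]
  refine multiplier_ext_fst fun b => ?_
  have h2 : (v n * star (v n)).fst = ContinuousLinearMap.id ℂ B := by
    refine ContinuousLinearMap.ext_on (s := {x : B | ∃ (a : A) (b : B), x = j a * b}) ?_ ?_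
    · rw [dense_iff_closure_eq, ← Submodule.topologicalClosure_coe, hB.nondegenerate]; rfl
    · rintro _ ⟨a, b, rfl⟩
      rw [multiplier_fst_mul]
      have h4 : ((v n * star (v n)).fst (j a) : 𝓜(ℂ, B)) = j a := by rw [coe_fst_eq_mul, h1]
      rw [coe_multiplier_injective h4]
      rfl
  rw [h2]
  rfl

theorem IsPisoCrossedProduct.v_zero (hB : IsPisoCrossedProduct α j v) : v 0 = 1 := by
  have h1 := hB.isRep.map_add 0 0
  have h2 := hB.mul_star 0
  calc v 0 = v 0 * (v 0 * star (v 0)) := by rw [h2, mul_one]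
    _ = 1 := by rw [← mul_assoc, ← h1]; exact h2

theorem IsPisoCrossedProduct.relations (hB : IsPisoCrossedProduct α j v) :
    Relations α (multiplierHom j) v where
  zero_mul x := by rw [hB.v_zero, one_mul]
  mul_zero x := by rw [hB.v_zero, mul_one]
  add := hB.isRep.map_add
  coiso n := by rw [hB.mul_star, hB.v_zero]
  comm n a := by
    rw [← coe_hom, ← coe_hom, hB.covariant, mul_assoc (v n * (j a : 𝓜(ℂ, B))), mul_assoc (v n),
      ← hB.commute, ← mul_assoc, ← mul_assoc, hB.mul_star, one_mul]

/-- The element of `B` whose image in the multiplier algebra is the word `v_n* j(a) v_m`. -/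
noncomputable def wordElt (j : A →⋆ₙₐ[ℂ] B) (v : ℕ → 𝓜(ℂ, B)) (n : ℕ) (a : A) (m : ℕ) : B :=
  (star (v n)).fst ((v m).snd (j a))

theorem coe_wordElt (n : ℕ) (a : A) (m : ℕ) :
    ((wordElt j v n a m : B) : 𝓜(ℂ, B)) = word (multiplierHom j) v n a m := by
  rw [wordElt, coe_fst_eq_mul, coe_snd_eq_mul, coe_hom, word, mul_assoc]

theorem IsPisoCrossedProduct.dense_wordElt (hB : IsPisoCrossedProduct α j v) :
    (Submodule.span ℂ {x : B | ∃ n a m, x = wordElt j v n a m}).topologicalClosure = ⊤ := by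
  rw [eq_top_iff, ← hB.dense]
  refine Submodule.topologicalClosure_mono (Submodule.span_mono ?_)
  rintro x ⟨n, m, a, hx⟩
  refine ⟨n, a, m, coe_multiplier_injective ?_⟩
  rw [coe_wordElt]
  exact hx

section IntegratedForm

variable {H : Type*} [NormedAddCommGroup H] [InnerProductSpace ℂ H] [CompleteSpace H]
  {π : A →⋆ₙₐ[ℂ] (H →L[ℂ] H)} {V : ℕ → (H →L[ℂ] H)} {ρ : B →⋆ₙₐ[ℂ] (H →L[ℂ] H)}

theorem IsIntegratedForm.map_snd_star (hρ : IsIntegratedForm j v π V ρ) (n : ℕ) (b : B) :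
    ρ ((star (v n)).snd b) = ρ b * star (V n) := by
  rw [DoubleCentralizer.star_snd, map_star, ← hρ.comp_right, star_mul, map_star, star_star]

/-- An integrated form is only prescribed on left multiplication by v_n. Multiplying by ρ(c) on the
left moves v_n* onto c by centrality, where adjoints reduce it to the prescribed case; nondegeneracy
removes ρ(c). -/
theorem IsIntegratedForm.map_fst_star (hρ : IsIntegratedForm j v π V ρ) (n : ℕ) (b : B) :
    ρ ((star (v n)).fst b) = star (V n) * ρ b := by
  ext x
  rw [← sub_eq_zero]
  refine hρ.nondegenerate.eq_zero fun c => ?_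
  rw [map_sub, sub_eq_zero]
  have h : ρ c * ρ ((star (v n)).fst b) = ρ c * (star (V n) * ρ b) := by
    rw [← map_mul, ← (star (v n)).central, map_mul, hρ.map_snd_star, mul_assoc]
  exact DFunLike.congr_fun h x

theorem IsIntegratedForm.map_snd (hρ : IsIntegratedForm j v π V ρ) (n : ℕ) (b : B) :
    ρ ((v n).snd b) = ρ b * V n := by
  have h := hρ.map_fst_star n (star b)
  rw [DoubleCentralizer.star_fst, star_star, map_star, map_star] at h
  have h2 := congrArg star h
  rwa [star_mul, star_star, star_star, star_star] at h2

theorem IsIntegratedForm.map_wordElt (hρ : IsIntegratedForm j v π V ρ) (n : ℕ) (a : A) (m : ℕ) :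
    ρ (wordElt j v n a m) = star (V n) * π a * V m := by
  rw [wordElt, hρ.map_fst_star, hρ.map_snd, hρ.comp_left, mul_assoc]

end IntegratedForm

end CrossedProduct

/-! ### Matrix units in the crossed product and irreducibility. -/

section CrossedProduct

variable {A : Type u} [NonUnitalCStarAlgebra A] {B : Type u}
  [NonUnitalCStarAlgebra B]

/-- The elements `v_n* j(a) (1 - v_1* v_1) v_m` of the crossed product. -/
noncomputable def cornerElt (α : A ≃⋆ₐ[ℂ] A) (j : A →⋆ₙₐ[ℂ] B) (v : ℕ → 𝓜(ℂ, B)) (n : ℕ) (a : A)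
    (m : ℕ) : B :=
  wordElt j v n a m - wordElt j v (n + 1) (α a) (m + 1)

variable {α : A ≃⋆ₐ[ℂ] A} {j : A →⋆ₙₐ[ℂ] B} {v : ℕ → 𝓜(ℂ, B)}
  {H : Type*} [NormedAddCommGroup H] [InnerProductSpace ℂ H] [CompleteSpace H]
  {π : A →⋆ₙₐ[ℂ] (H →L[ℂ] H)} {ρ : B →⋆ₙₐ[ℂ] (SqSum H →L[ℂ] SqSum H)}

theorem star_shiftRep_mul_apply (n : ℕ) (a : A) (m : ℕ) (ξ : SqSum H) (k : ℕ) :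
    (star (shiftRep H n) * diagRep α π a * shiftRep H m) ξ k =
      if n ≤ k then π (α^[k - n] a) (ξ (k - n + m)) else 0 := by
  change star (shiftRep H n) (diagRep α π a (shiftRep H m ξ)) k = _
  rw [star_shiftRep_apply]
  rfl

/-- Both words have the same entries on the same diagonal, except that the second one starts one row
later. The difference keeps only row n. -/
theorem IsIntegratedForm.cornerElt_apply
    (hρ : IsIntegratedForm j v (diagRep α π) (shiftRep H) ρ) (n : ℕ) (a : A) (m : ℕ)
    (ξ : SqSum H) : ρ (cornerElt α j v n a m) ξ = coordIncl H n (π a (ξ m)) := by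
  ext k
  rw [cornerElt, map_sub, hρ.map_wordElt, hρ.map_wordElt, coordIncl_apply]
  change (star (shiftRep H n) * diagRep α π a * shiftRep H m) ξ k -
    (star (shiftRep H (n + 1)) * diagRep α π (α a) * shiftRep H (m + 1)) ξ k = _
  rw [star_shiftRep_mul_apply, star_shiftRep_mul_apply]
  rcases lt_trichotomy k n with h | rfl | h
  · rw [if_neg (by omega), if_neg (by omega), if_neg (by omega), sub_zero]
  · rw [if_pos le_rfl, if_neg (by omega), if_pos rfl, sub_zero, Nat.sub_self, zero_add]
    rfl
  · obtain ⟨d, rfl⟩ := Nat.exists_eq_add_of_lt h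
    rw [if_pos (by omega), if_pos (by omega),
      show n + d + 1 - n = d + 1 by omega, show n + d + 1 - (n + 1) = d by omega, if_neg (by omega),
      show d + (m + 1) = d + 1 + m by omega, Function.iterate_succ_apply, sub_self]

theorem IsIntegratedForm.eq_zero_of_cornerElt
    (hρ : IsIntegratedForm j v (diagRep α π) (shiftRep H) ρ) {a : A}
    (h : ρ (cornerElt α j v 0 a 0) = 0) : π a = 0 := by
  refine ContinuousLinearMap.ext fun x => ?_
  have h1 := hρ.cornerElt_apply 0 a 0 (coordIncl H 0 x)
  rw [h, coordIncl_apply, if_pos rfl] at h1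
  have h2 := congrArg (fun ξ : SqSum H => ξ 0) h1
  simp only [coordIncl_apply, if_true] at h2
  exact h2.symm

theorem IsIntegratedForm.isIrreducibleRep (h0 : π ≠ 0) (hπ : IsIrreducibleRep π)
    (hρ : IsIntegratedForm j v (diagRep α π) (shiftRep H) ρ) : IsIrreducibleRep ρ := by
  intro K hK hinv
  refine or_iff_not_imp_left.2 fun hne => ?_
  obtain ⟨ξ, hξ, hξ0⟩ := Submodule.exists_mem_ne_zero_of_ne_bot hne
  obtain ⟨m, hm⟩ : ∃ m, ξ m ≠ 0 := by
    by_contra! h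
    exact hξ0 (lp.ext (funext h))
  refine eq_top_of_coordIncl_mem hK fun n x => ?_
  have h1 : K.comap (coordIncl H n).toLinearMap = ⊤ := by
    -- The x with ε_n x in K, where ε_n embeds H in position n, form a closed subspace that contains
    -- π(A)ξ(m), and ξ(m) is cyclic.
    refine hπ.eq_top_of_apply_mem h0 hm (hK.preimage (coordIncl H n).continuous) fun a => ?_
    have := hinv (cornerElt α j v n a m) ξ hξ
    rwa [hρ.cornerElt_apply] at this
  exact (h1 ▸ Submodule.mem_top : x ∈ K.comap (coordIncl H n).toLinearMap)

end CrossedProduct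

/-! ### Norms of matrices over a C*-algebra. -/

section MatrixNorm

/-- The two sums are the squared norms of the row rM and of the row r in the Hilbert module of rows,
on which M acts with norm at most ‖M‖. -/
theorem norm_sum_mul_star_le {P : Type*} [NonUnitalCStarAlgebra P] [PartialOrder P]
    [StarOrderedRing P] {ι : Type*} [Fintype ι] (M : CStarMatrix ι ι P) (r : ι → P) :
    ‖∑ i, (∑ k, r k * M k i) * star (∑ k, r k * M k i)‖ ≤ ‖M‖ ^ 2 * ‖∑ k, r k * star (r k)‖ := by
  let w : WithCStarModule P (ι → P) := (WithCStarModule.equiv P (ι → P)).symm r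
  have h := (CStarMatrix.toCLM M).le_opNorm w
  have h2 := pow_le_pow_left₀ (norm_nonneg _) h 2
  rw [mul_pow, WithCStarModule.pi_norm_sq, WithCStarModule.pi_norm_sq,
    CStarMatrix.toCLM_apply_eq_sum] at h2
  exact h2

variable {A H K : Type*} [NonUnitalCStarAlgebra A] [PartialOrder A]
    [StarOrderedRing A] [NormedAddCommGroup H] [InnerProductSpace ℂ H]
    [CompleteSpace H] [NormedAddCommGroup K] [InnerProductSpace ℂ K] [CompleteSpace K]
    {ι : Type*} [Fintype ι]

open ContinuousLinearMap in
/-- The representation of matrices over `A` on the sum of copies of `H` embedded in `K`. -/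
noncomputable def matrixRep [DecidableEq ι] (π : A →⋆ₙₐ[ℂ] (H →L[ℂ] H)) (s : ι → (H →L[ℂ] K))
    (hs : ∀ i k x, adjoint (s i) (s k x) = if i = k then x else 0) :
    CStarMatrix ι ι A →⋆ₙₐ[ℂ] (K →L[ℂ] K) where
  toFun M := ∑ i, ∑ k, s i ∘L π (M i k) ∘L adjoint (s k)
  map_smul' c M := by
    simp [Finset.smul_sum]
  map_zero' := by
    simp
  map_add' M N := by
    simp [Finset.sum_add_distrib]
  map_mul' M N := by
    ext x
    have hite : ∀ (T : H →L[ℂ] H) (i k : ι) y, T (if i = k then y else 0) =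
        if i = k then T y else 0 := fun T i k y => by split_ifs <;> simp
    simp only [CStarMatrix.mul_apply, map_sum, map_mul]
    change (∑ i, ∑ k, s i ∘L (∑ l, π (M i l) * π (N l k)) ∘L adjoint (s k)) x =
      (∑ i, ∑ l, s i ∘L π (M i l) ∘L adjoint (s l))
        ((∑ i, ∑ k, s i ∘L π (N i k) ∘L adjoint (s k)) x)
    have hite' : ∀ (l i k : ι) y, s l (if i = k then y else 0) =
        if i = k then s l y else 0 := fun l i k y => by split_ifs <;> simp
    simp only [sum_apply, comp_apply, map_sum, hs, hite, hite', Finset.sum_ite_eq',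
      Finset.mem_univ, if_true]
    rw [Finset.sum_comm]
    conv_rhs => rw [Finset.sum_comm]
    exact Finset.sum_congr rfl fun k _ => Finset.sum_comm
  map_star' M := by
    simp only [star_sum, star_eq_adjoint, adjoint_comp, adjoint_adjoint]
    rw [Finset.sum_comm]
    refine Finset.sum_congr rfl fun i _ => Finset.sum_congr rfl fun k _ => ?_
    rw [CStarMatrix.star_apply, map_star, star_eq_adjoint]
    rfl

-- A faithful π gives a faithful, hence isometric, representation of the matrices, and there M
-- becomes the compression of R to the sum of the copies of H.
open ContinuousLinearMap in
theorem norm_matrix_le {π : A →⋆ₙₐ[ℂ] (H →L[ℂ] H)} (hπ : Function.Injective π)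
    (s : ι → (H →L[ℂ] K)) [DecidableEq ι]
    (hs : ∀ i k x, adjoint (s i) (s k x) = if i = k then x else 0) (R : K →L[ℂ] K)
    (M : CStarMatrix ι ι A) (hR : ∀ i k, adjoint (s i) ∘L R ∘L s k = π (M i k)) : ‖M‖ ≤ ‖R‖ := by
  have hinj : Function.Injective (matrixRep π s hs) := by
    refine (injective_iff_map_eq_zero _).2 fun N hN => CStarMatrix.ext fun i k => hπ ?_
    ext x
    have h1 := congrArg (adjoint (s i)) (DFunLike.congr_fun hN (s k x))
    change adjoint (s i) ((∑ i, ∑ k, s i ∘L π (N i k) ∘L adjoint (s k)) (s k x)) = _ at h1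
    have hite : ∀ (T : H →L[ℂ] H) (i k : ι) y, T (if i = k then y else 0) =
        if i = k then T y else 0 := fun T i k y => by split_ifs <;> simp
    simpa [sum_apply, hs, hite] using h1
  -- The projection onto the sum of the ranges of the s i.
  let Q : K →L[ℂ] K := ∑ i, s i ∘L adjoint (s i)
  have hQ : ‖Q‖ ≤ 1 := by
    refine IsStarProjection.norm_le Q ⟨?_, ?_⟩
    · ext x
      have hite : ∀ (i k : ι) y, s i (if i = k then y else 0) =
          if i = k then s i y else 0 := fun i k y => by split_ifs <;> simp
      simp [Q, sum_apply, hs, hite]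
    · simp [Q, IsSelfAdjoint, star_eq_adjoint, adjoint_comp]
  have hM : matrixRep π s hs M = Q ∘L R ∘L Q := by
    change ∑ i, ∑ k, s i ∘L π (M i k) ∘L adjoint (s k) = _
    ext x
    simp only [Q, ← hR, sum_apply, comp_apply, map_sum]
    exact Finset.sum_comm
  rw [← NonUnitalStarAlgHom.norm_map _ hinj M, hM]
  calc ‖Q ∘L R ∘L Q‖ ≤ ‖Q‖ * (‖R‖ * ‖Q‖) :=
        (opNorm_comp_le _ _).trans (by gcongr; exact opNorm_comp_le _ _)
    _ ≤ 1 * (‖R‖ * 1) := by gcongr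
    _ = ‖R‖ := by ring

end MatrixNorm

/-! ### Matrices relative to the coisometries v_n, and the averaging estimate. -/

section Coisometries

variable {A P : Type*} [NonUnitalCStarAlgebra A] [CStarAlgebra P] {α : A ≃⋆ₐ[ℂ] A}
  {J : A →⋆ₙₐ[ℂ] P} {v : ℕ → P}

theorem Relations.mul_star_self (h : Relations α J v) (n : ℕ) : v n * star (v n) = 1 := by
  have := h.zero_mul 1
  rw [mul_one] at this
  rw [h.coiso, this]

theorem Relations.mul_star_of_le (h : Relations α J v) {n m : ℕ} (hm : m ≤ n) :
    v n * star (v m) = v (n - m) := by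
  obtain ⟨d, rfl⟩ := Nat.exists_eq_add_of_le' hm
  rw [h.add, mul_assoc, h.mul_star_self, mul_one, Nat.add_sub_cancel]

theorem Relations.mul_star_of_ge (h : Relations α J v) {n m : ℕ} (hm : n ≤ m) :
    v n * star (v m) = star (v (m - n)) := by
  rw [← h.mul_star_of_le hm, star_mul, star_star]

theorem Relations.norm_le_one (h : Relations α J v) (n : ℕ) : ‖v n‖ ≤ 1 := by
  have h1 : ‖v n‖ * ‖v n‖ ≤ 1 := by
    rw [← CStarRing.norm_self_mul_star, h.mul_star_self]
    rcases subsingleton_or_nontrivial P with hP | hP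
    · rw [Subsingleton.elim (1 : P) 0]; simp
    · simp
  nlinarith [norm_nonneg (v n)]

/-- The projection `1 - v_1* v_1`. -/
def defect (v : ℕ → P) : P := 1 - star (v 1) * v 1

theorem star_defect (v : ℕ → P) : star (defect v) = defect v := by
  simp [defect]

theorem Relations.mul_defect (h : Relations α J v) (n : ℕ) : v (n + 1) * defect v = 0 := by
  rw [defect, mul_sub, mul_one, ← mul_assoc, h.mul_star_of_le (by omega), Nat.add_sub_cancel,
    ← h.add, sub_self]

theorem Relations.defect_mul_star (h : Relations α J v) (n : ℕ) :
    defect v * star (v (n + 1)) = 0 := by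
  rw [← star_defect, ← star_mul, h.mul_defect, star_zero]

theorem Relations.defect_mul_self (h : Relations α J v) : defect v * defect v = defect v := by
  nth_rw 1 [defect]
  rw [sub_mul, mul_assoc, h.mul_defect 0, MulZeroClass.mul_zero, one_mul, sub_zero]

theorem Relations.defect_comm (h : Relations α J v) (a : A) :
    defect v * J a = J a * defect v := by
  rw [defect, sub_mul, mul_sub, one_mul, mul_one, mul_assoc, h.comm, ← mul_assoc, ← mul_assoc,
    h.star_comm]

theorem Relations.defect_mul_mul_star_mul_defect (h : Relations α J v) (n m : ℕ) :
    defect v * v n * star (v m) * defect v = if n = m then defect v else 0 := by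
  rcases lt_trichotomy n m with hn | rfl | hn
  · obtain ⟨d, rfl⟩ := Nat.exists_eq_add_of_lt hn
    rw [if_neg (by omega), mul_assoc (defect v), h.mul_star_of_ge hn.le,
      show n + d + 1 - n = d + 1 by omega, h.defect_mul_star, MulZeroClass.zero_mul]
  · rw [if_pos rfl, mul_assoc (defect v), h.mul_star_self, mul_one, h.defect_mul_self]
  · obtain ⟨d, rfl⟩ := Nat.exists_eq_add_of_lt hn
    rw [if_neg (by omega), mul_assoc (defect v), h.mul_star_of_le hn.le,
      show m + d + 1 - m = d + 1 by omega, mul_assoc, h.mul_defect, MulZeroClass.mul_zero]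

/-- Telescoping: the n-th term is p_n - p_{n+1} with p_n = v_n* v_n. -/
theorem Relations.sum_defect (h : Relations α J v) (N : ℕ) :
    ∑ n ∈ Finset.range N, star (v n) * defect v * v n = 1 - star (v N) * v N := by
  induction N with
  | zero =>
    have h0 : v 0 = 1 := by simpa using h.zero_mul 1
    simp [h0]
  | succ N ih =>
    rw [Finset.sum_range_succ, ih, defect, mul_sub, sub_mul, mul_one, add_comm N 1, h.add 1 N,
      star_mul]
    simp only [mul_assoc]
    abel

variable {H : Type*} [NormedAddCommGroup H] [InnerProductSpace ℂ H] [CompleteSpace H]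

/-- `T` is the matrix of the operator `R` on `ℓ²(ℕ, H)`, and of the element `x` of `P` with respect
to the coisometries `v`: this holds exactly in the corners at `1 - v_1* v_1`, and up to finitely many
columns otherwise. -/
structure IsMatrixOf (J : A →⋆ₙₐ[ℂ] P) (v : ℕ → P) (π : A →⋆ₙₐ[ℂ] (H →L[ℂ] H))
    (x : P) (R : SqSum H →L[ℂ] SqSum H) (L : ℕ) (T : ℕ → ℕ → A) : Prop where
  coeff : ∀ n m h, R (coordIncl H m h) n = π (T n m) h
  corner : ∀ n m, defect v * v n * x * star (v m) * defect v = J (T n m) * defect v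
  column : ∀ m N, L ≤ m → m + L ≤ N →
    x * star (v m) = ∑ n ∈ Finset.range N, star (v n) * J (T n m)

variable {π : A →⋆ₙₐ[ℂ] (H →L[ℂ] H)} {x y : P} {R S : SqSum H →L[ℂ] SqSum H} {L L' : ℕ}
  {T T' : ℕ → ℕ → A}

theorem isMatrixOf_zero : IsMatrixOf J v π 0 0 0 0 where
  coeff := by intros; simp
  corner := by simp
  column := by simp

theorem IsMatrixOf.add (h : IsMatrixOf J v π x R L T) (h' : IsMatrixOf J v π y S L' T') :
    IsMatrixOf J v π (x + y) (R + S) (L + L') (T + T') where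
  coeff n m z := by
    change R (coordIncl H m z) n + S (coordIncl H m z) n = _
    rw [h.coeff, h'.coeff]
    simp
  corner n m := by
    rw [Pi.add_apply, Pi.add_apply, map_add, add_mul, ← h.corner, ← h'.corner]
    simp only [mul_add, add_mul]
  column m N hm hN := by
    rw [add_mul, h.column m N (by omega) (by omega), h'.column m N (by omega) (by omega),
      ← Finset.sum_add_distrib]
    simp [mul_add]

theorem IsMatrixOf.smul (c : ℂ) (h : IsMatrixOf J v π x R L T) :
    IsMatrixOf J v π (c • x) (c • R) L (c • T) where
  coeff n m z := by
    change c • R (coordIncl H m z) n = _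
    rw [h.coeff]
    simp
  corner n m := by
    rw [Pi.smul_apply, Pi.smul_apply, map_smul, smul_mul_assoc, ← h.corner]
    simp only [mul_smul_comm, smul_mul_assoc]
  column m N hm hN := by
    rw [smul_mul_assoc, h.column m N hm hN, Finset.smul_sum]
    simp

/-- Column m ≥ l of v_k* a v_l has one entry, in row m - l + k, because v_k* a v_{m-l}* = v_{m-l+k}*
α^{m-l}(a). The bound k + l + 1 ensures both that m ≥ l and that this row is below N. -/
theorem Relations.isMatrixOf_word (h : Relations α J v) (k : ℕ) (a : A) (l : ℕ) :
    IsMatrixOf J v π (word J v k a l) (star (shiftRep H k) * diagRep α π a * shiftRep H l)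
      (k + l + 1)
      (fun n m => if l ≤ m ∧ n = m - l + k then α^[m - l] a else 0) where
  coeff n m z := by
    rw [star_shiftRep_mul_apply, coordIncl_apply]
    split_ifs with h1 h2 h3 h4 h5
    · rw [show n - k = m - l by omega]
    · omega
    · omega
    · simp
    · omega
    · simp
  corner n m := by
    rw [word]
    have e : defect v * v n * (star (v k) * J a * v l) * star (v m) * defect v =
        defect v * (v n * star (v k)) * J a * ((v l * star (v m)) * defect v) := by
      simp only [mul_assoc]
    rw [e]
    rcases lt_or_ge n k with hn | hn
    · obtain ⟨d, rfl⟩ := Nat.exists_eq_add_of_lt hn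
      rw [if_neg (by omega), h.mul_star_of_ge hn.le, show n + d + 1 - n = d + 1 by omega,
        h.defect_mul_star]
      simp
    rcases lt_or_ge m l with hm | hm
    · obtain ⟨d, rfl⟩ := Nat.exists_eq_add_of_lt hm
      rw [if_neg (by omega), h.mul_star_of_le hm.le, show m + d + 1 - m = d + 1 by omega,
        h.mul_defect]
      simp
    rw [h.mul_star_of_le hn, h.mul_star_of_ge hm, mul_assoc (defect v), h.comm]
    have e2 : defect v * (J (α^[n - k] a) * v (n - k)) * (star (v (m - l)) * defect v) =
        J (α^[n - k] a) * (defect v * v (n - k) * star (v (m - l)) * defect v) := by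
      simp only [← mul_assoc, h.defect_comm]
    rw [e2, h.defect_mul_mul_star_mul_defect]
    by_cases hnm : n - k = m - l
    · rw [if_pos hnm, if_pos (by omega), hnm]
    · rw [if_neg hnm, if_neg (by omega)]
      simp
  column m N hm hN := by
    rw [Finset.sum_eq_single (m - l + k)]
    · rw [if_pos (by omega), word, mul_assoc, h.mul_star_of_ge (by omega), mul_assoc, h.star_comm,
        ← mul_assoc, ← star_mul, ← h.add]
    · intro b _ hb
      rw [if_neg (by omega)]
      simp
    · intro hb
      rw [Finset.mem_range] at hb
      omega

/-- The corner is J(T n m)d, of norm at most ‖T n m‖. By faithfulness this is the norm of the entry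
π(T n m) of R. -/
theorem IsMatrixOf.norm_corner_le (h : IsMatrixOf J v π x R L T) (hr : Relations α J v)
    (hπ : Function.Injective π) (n m : ℕ) :
    ‖defect v * v n * x * star (v m) * defect v‖ ≤ ‖R‖ := by
  have hd : ‖defect v‖ ≤ 1 := IsStarProjection.norm_le _ ⟨hr.defect_mul_self, star_defect v⟩
  have h1 : ‖π (T n m)‖ ≤ ‖R‖ := by
    refine ContinuousLinearMap.opNorm_le_bound _ (norm_nonneg _) fun z => ?_
    rw [← h.coeff]
    refine (lp.norm_apply_le_norm two_ne_zero _ n).trans ((R.le_opNorm _).trans ?_)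
    gcongr
    exact (lp.norm_single (E := fun _ : ℕ => H) two_pos m z).le
  rw [h.corner]
  calc ‖J (T n m) * defect v‖ ≤ ‖J (T n m)‖ * ‖defect v‖ := norm_mul_le _ _
    _ ≤ ‖T n m‖ * 1 := by
      gcongr
      exact NonUnitalStarAlgHom.norm_apply_le J _
    _ = ‖π (T n m)‖ := by rw [mul_one, NonUnitalStarAlgHom.norm_map π hπ]
    _ ≤ ‖R‖ := h1

open ContinuousLinearMap in
theorem adjoint_coordIncl_apply (n : ℕ) (ξ : SqSum H) : adjoint (coordIncl H n) ξ = ξ n :=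
  ext_inner_left ℂ fun z => by
    rw [adjoint_inner_right, inner_coordIncl_left]

/-- The averaging estimate: columns of `x` far out are bounded by the operator `R`. -/
theorem IsMatrixOf.mul_norm_sq_le (h : IsMatrixOf J v π x R L T) (hr : Relations α J v)
    (hπ : Function.Injective π) (M : ℕ) :
    M * ‖x * star (v (L + M))‖ ^ 2 ≤ ‖R‖ ^ 2 * (2 * L + M) := by
  let _ := CStarAlgebra.spectralOrder A
  have := CStarAlgebra.spectralOrderedRing A
  let _ := CStarAlgebra.spectralOrder P
  have := CStarAlgebra.spectralOrderedRing P
  -- Columns L, ..., L + M - 1 have all their nonzero entries in rows below N, so the N × N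
  -- truncation contains them completely.
  set N := 2 * L + M with hN
  let W : CStarMatrix (Fin N) (Fin N) A := CStarMatrix.ofMatrix fun n m => T n m
  let D : CStarMatrix (Fin N) (Fin N) P := CStarMatrix.mapₙₐ J W
  have hW : ‖W‖ ≤ ‖R‖ := by
    refine norm_matrix_le hπ (fun n : Fin N => coordIncl H n) (fun i k z => ?_) R W fun i k => ?_
    · rw [adjoint_coordIncl_apply, coordIncl_apply]
      simp only [Fin.ext_iff]
    · ext z
      change ContinuousLinearMap.adjoint (coordIncl H i) (R (coordIncl H k z)) = _
      rw [adjoint_coordIncl_apply, h.coeff]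
      rfl
  have hD : ‖D‖ ≤ ‖R‖ := (NonUnitalStarAlgHom.norm_apply_le (CStarMatrix.mapₙₐ J) W).trans hW
  have key := norm_sum_mul_star_le D (fun n : Fin N => star (v n))
  -- Since v_m* v_m decreases in m, x v_m* v_m x* dominates x v_{L+M}* v_{L+M} x* for every m < L +
  -- M. All M columns can therefore be compared with the single column L + M.
  have hz : ∀ m ∈ Finset.Ico L (L + M), x * star (v (L + M)) * star (x * star (v (L + M))) ≤
      (∑ n ∈ Finset.range N, star (v n) * J (T n m)) *
        star (∑ n ∈ Finset.range N, star (v n) * J (T n m)) := by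
    intro m hm
    rw [Finset.mem_Ico] at hm
    rw [← h.column m N hm.1 (by omega)]
    obtain ⟨d, hd⟩ := Nat.exists_eq_add_of_le' hm.2.le
    rw [hd, hr.add]
    have hp : (1 - star (v d) * v d) * (1 - star (v d) * v d) = 1 - star (v d) * v d := by
      have : star (v d) * v d * (star (v d) * v d) = star (v d) * v d := by
        rw [mul_assoc, ← mul_assoc (v d), hr.mul_star_self, one_mul]
      rw [mul_sub, sub_mul _ _ (star (v d) * v d), this]
      simp
    have e : x * star (v m) * star (x * star (v m)) -
        x * star (v d * v m) * star (x * star (v d * v m)) =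
        (x * star (v m) * (1 - star (v d) * v d)) *
          star (x * star (v m) * (1 - star (v d) * v d)) := by
      have hs : star (1 - star (v d) * v d) = 1 - star (v d) * v d := by simp
      rw [star_mul (x * star (v m)), hs, mul_assoc (x * star (v m)), ← mul_assoc (1 - _), hp]
      simp only [star_mul, star_star, mul_sub, sub_mul, mul_assoc, one_mul]
    rw [← sub_nonneg, e]
    exact mul_star_self_nonneg _
  have hsum : M • (x * star (v (L + M)) * star (x * star (v (L + M)))) ≤
      ∑ m : Fin N, (∑ n : Fin N, star (v n) * D n m) * star (∑ n : Fin N, star (v n) * D n m) := by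
    have e : ∀ m : Fin N, ∑ n : Fin N, star (v n) * D n m =
        ∑ n ∈ Finset.range N, star (v n) * J (T n m) := fun m =>
      (Finset.sum_range fun n => star (v n) * J (T n m)).symm
    simp only [e]
    rw [← Finset.sum_range fun m => (∑ n ∈ Finset.range N, star (v n) * J (T n m)) *
      star (∑ n ∈ Finset.range N, star (v n) * J (T n m))]
    have h1 := Finset.card_nsmul_le_sum _ _ _ hz
    rw [Nat.card_Ico, Nat.add_sub_cancel_left] at h1
    refine h1.trans (Finset.sum_le_sum_of_subset_of_nonneg (fun m hm => ?_) fun m _ _ =>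
      mul_star_self_nonneg _)
    rw [Finset.mem_Ico] at hm
    rw [Finset.mem_range]
    omega
  have hle := CStarAlgebra.norm_le_norm_of_nonneg_of_le
    (nsmul_nonneg (mul_star_self_nonneg _) M) hsum
  -- The crude bound by the number of rows suffices: only the ratio N/M matters.
  have hrow : ‖∑ n : Fin N, star (v n) * star (star (v n))‖ ≤ 2 * L + M := by
    refine (norm_sum_le _ _).trans ((Finset.sum_le_card_nsmul _ _ 1 fun n _ => ?_).trans ?_)
    · rw [star_star]
      refine (norm_mul_le _ _).trans ?_
      rw [norm_star]
      exact mul_le_one₀ (hr.norm_le_one _) (norm_nonneg _) (hr.norm_le_one _)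
    · simp [hN]
  calc M * ‖x * star (v (L + M))‖ ^ 2
      = ‖M • (x * star (v (L + M)) * star (x * star (v (L + M))))‖ := by
        rw [← Nat.cast_smul_eq_nsmul ℝ, norm_smul, CStarRing.norm_self_mul_star, sq]
        simp
    _ ≤ ‖D‖ ^ 2 * ‖∑ n : Fin N, star (v n) * star (star (v n))‖ := hle.trans key
    _ ≤ ‖R‖ ^ 2 * (2 * L + M) := by gcongr

end Coisometries

/-! ### Faithfulness of Π × V. -/

section Faithful

open Filter Topology

variable {A : Type u} [NonUnitalCStarAlgebra A] {α : A ≃⋆ₐ[ℂ] A} {B : Type u}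
  [NonUnitalCStarAlgebra B] {j : A →⋆ₙₐ[ℂ] B} {v : ℕ → 𝓜(ℂ, B)}
  {H : Type*} [NormedAddCommGroup H] [InnerProductSpace ℂ H] [CompleteSpace H]
  {π : A →⋆ₙₐ[ℂ] (H →L[ℂ] H)} {ρ : B →⋆ₙₐ[ℂ] (SqSum H →L[ℂ] SqSum H)}

theorem norm_coe_multiplier (b : B) : ‖(b : 𝓜(ℂ, B))‖ = ‖b‖ :=
  NonUnitalStarAlgHom.norm_map (DoubleCentralizer.coeHom (𝕜 := ℂ) (A := B))
    coe_multiplier_injective b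

theorem coe_multiplier_sub (b c : B) : ((b - c : B) : 𝓜(ℂ, B)) = (b : 𝓜(ℂ, B)) - (c : 𝓜(ℂ, B)) :=
  map_sub (DoubleCentralizer.coeHom (𝕜 := ℂ) (A := B)) b c

theorem continuous_coe_multiplier : Continuous ((↑) : B → 𝓜(ℂ, B)) :=
  (NonUnitalStarAlgHom.isometry (DoubleCentralizer.coeHom (𝕜 := ℂ) (A := B))
    coe_multiplier_injective).continuous

theorem continuous_nonUnitalStarAlgHom {B C : Type*} [NonUnitalCStarAlgebra B]
    [NonUnitalCStarAlgebra C] (ρ : B →⋆ₙₐ[ℂ] C) : Continuous ρ :=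
  AddMonoidHomClass.continuous_of_bound ρ 1 fun b => by
    rw [one_mul]
    exact NonUnitalStarAlgHom.norm_apply_le ρ b

theorem IsPisoCrossedProduct.exists_isMatrixOf (hB : IsPisoCrossedProduct α j v)
    (hρ : IsIntegratedForm j v (diagRep α π) (shiftRep H) ρ) {x : B}
    (hx : x ∈ Submodule.span ℂ {x : B | ∃ n a m, x = wordElt j v n a m}) :
    ∃ L T, IsMatrixOf (multiplierHom j) v π (x : 𝓜(ℂ, B)) (ρ x) L T := by
  induction hx using Submodule.span_induction with
  | mem x hx =>
    obtain ⟨n, a, m, rfl⟩ := hx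
    rw [coe_wordElt, hρ.map_wordElt]
    exact ⟨_, _, hB.relations.isMatrixOf_word n a m⟩
  | zero =>
    refine ⟨0, 0, ?_⟩
    rw [map_zero, show ((0 : B) : 𝓜(ℂ, B)) = 0 from
      map_zero (DoubleCentralizer.coeHom (𝕜 := ℂ) (A := B))]
    exact isMatrixOf_zero
  | add x y _ _ hx hy =>
    obtain ⟨L, T, hx⟩ := hx
    obtain ⟨L', T', hy⟩ := hy
    rw [map_add, show ((x + y : B) : 𝓜(ℂ, B)) = (x : 𝓜(ℂ, B)) + (y : 𝓜(ℂ, B)) from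
      map_add (DoubleCentralizer.coeHom (𝕜 := ℂ) (A := B)) x y]
    exact ⟨_, _, hx.add hy⟩
  | smul c x _ hx =>
    obtain ⟨L, T, hx⟩ := hx
    rw [map_smul, show ((c • x : B) : 𝓜(ℂ, B)) = c • (x : 𝓜(ℂ, B)) from
      map_smul (DoubleCentralizer.coeHom (𝕜 := ℂ) (A := B)) c x]
    exact ⟨_, _, hx.smul c⟩

theorem IsPisoCrossedProduct.dense_span_wordElt (hB : IsPisoCrossedProduct α j v) :
    Dense (Submodule.span ℂ {x : B | ∃ n a m, x = wordElt j v n a m} : Set B) :=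
  Submodule.dense_iff_topologicalClosure_eq_top.2 hB.dense_wordElt

theorem IsIntegratedForm.norm_corner_le (hB : IsPisoCrossedProduct α j v)
    (hρ : IsIntegratedForm j v (diagRep α π) (shiftRep H) ρ) (hπ : Function.Injective π)
    (n m : ℕ) (b : B) :
    ‖defect v * v n * (b : 𝓜(ℂ, B)) * star (v m) * defect v‖ ≤ ‖ρ b‖ := by
  have hc : IsClosed {b : B | ‖defect v * v n * (b : 𝓜(ℂ, B)) * star (v m) * defect v‖ ≤ ‖ρ b‖} := by
    have h1 := continuous_coe_multiplier (B := B)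
    have h2 := continuous_nonUnitalStarAlgHom ρ
    exact isClosed_le (by fun_prop) (by fun_prop)
  refine hc.closure_subset_iff.2 (fun x hx => ?_) (hB.dense_span_wordElt b)
  obtain ⟨L, T, h⟩ := hB.exists_isMatrixOf hρ hx
  exact h.norm_corner_le hB.relations hπ n m

/-- Approximate b by x in the span of the words; then ρ(x) is small, and the averaging estimate
makes x v_m* small for all large m. -/
theorem IsIntegratedForm.tendsto_mul_star (hB : IsPisoCrossedProduct α j v)
    (hρ : IsIntegratedForm j v (diagRep α π) (shiftRep H) ρ) (hπ : Function.Injective π)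
    {b : B} (hb : ρ b = 0) : Tendsto (fun m => (b : 𝓜(ℂ, B)) * star (v m)) atTop (𝓝 0) := by
  rw [Metric.tendsto_atTop]
  intro δ hδ
  obtain ⟨ε, hε, hεδ⟩ : ∃ ε > 0, 3 * ε < δ := ⟨δ / 4, by positivity, by linarith⟩
  obtain ⟨x, hx, hxb⟩ := Metric.dense_iff.1 hB.dense_span_wordElt b ε hε
  rw [Metric.mem_ball, dist_eq_norm] at hx
  obtain ⟨L, T, h⟩ := hB.exists_isMatrixOf hρ hxb
  have hρx : ‖ρ x‖ ≤ ε := by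
    have := NonUnitalStarAlgHom.norm_apply_le ρ (x - b)
    rw [map_sub, hb, sub_zero] at this
    exact this.trans hx.le
  refine ⟨L + (2 * L + 1), fun m hm => ?_⟩
  obtain ⟨M, rfl⟩ := Nat.exists_eq_add_of_le (show L ≤ m by omega)
  -- This gives M > 0 and 2L + M ≤ 4M, so the averaging estimate yields ‖x v_{L+M}*‖ ≤ 2ε. Replacing
  -- x by b costs one more ε.
  have hM : 2 * L + 1 ≤ M := by omega
  have h1 := h.mul_norm_sq_le hB.relations hπ M
  have hM' : (2 * L + 1 : ℝ) ≤ M := by exact_mod_cast hM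
  have h2 : ‖(x : 𝓜(ℂ, B)) * star (v (L + M))‖ ≤ 2 * ε := by
    refine abs_le_of_sq_le_sq' ?_ (by positivity) |>.2
    have h3 : ‖ρ x‖ ^ 2 ≤ ε ^ 2 := by gcongr
    have h4 : M * ‖(x : 𝓜(ℂ, B)) * star (v (L + M))‖ ^ 2 ≤ M * (2 * ε) ^ 2 := by
      refine h1.trans ?_
      calc ‖ρ x‖ ^ 2 * (2 * L + M) ≤ ε ^ 2 * (4 * M) := by
            gcongr
            have : (0 : ℝ) ≤ L := L.cast_nonneg
            linarith
        _ = M * (2 * ε) ^ 2 := by ring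
    have : (0 : ℝ) < M := by
      have : (0 : ℝ) ≤ L := L.cast_nonneg
      linarith
    exact le_of_mul_le_mul_left h4 this
  rw [dist_zero_right]
  calc ‖(b : 𝓜(ℂ, B)) * star (v (L + M))‖
      = ‖(x : 𝓜(ℂ, B)) * star (v (L + M)) - ((x - b : B) : 𝓜(ℂ, B)) * star (v (L + M))‖ := by
        rw [coe_multiplier_sub, sub_mul, sub_sub_cancel]
    _ ≤ 2 * ε + ε * 1 := by
        refine (norm_sub_le _ _).trans (add_le_add h2 ((norm_mul_le _ _).trans ?_))
        rw [norm_coe_multiplier, norm_star]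
        gcongr
        exact hB.relations.norm_le_one _
    _ < δ := by linarith

/-- Vanishing corners kill every finite block of b, and the decay of b v_M* makes b the limit of b(1
- v_M* v_M). The kernel is self-adjoint, so the same argument on the other side uses b*. -/
theorem IsIntegratedForm.injective (hB : IsPisoCrossedProduct α j v)
    (hρ : IsIntegratedForm j v (diagRep α π) (shiftRep H) ρ) (hπ : Function.Injective π) :
    Function.Injective ρ := by
  refine (injective_iff_map_eq_zero ρ).2 fun b hb => ?_
  have hcorner : ∀ n m, defect v * v n * (b : 𝓜(ℂ, B)) * star (v m) * defect v = 0 :=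
    fun n m => norm_le_zero_iff.1 <| by
      have := hρ.norm_corner_le hB hπ n m b
      rwa [hb, norm_zero] at this
  have h1 : ∀ N M, (1 - star (v N) * v N) * (b : 𝓜(ℂ, B)) * (1 - star (v M) * v M) = 0 := by
    intro N M
    rw [← hB.relations.sum_defect, ← hB.relations.sum_defect, Finset.sum_mul, Finset.sum_mul]
    refine Finset.sum_eq_zero fun n _ => ?_
    rw [Finset.mul_sum]
    refine Finset.sum_eq_zero fun m _ => ?_
    have e : star (v n) * defect v * v n * (b : 𝓜(ℂ, B)) * (star (v m) * defect v * v m) =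
        star (v n) * (defect v * v n * (b : 𝓜(ℂ, B)) * star (v m) * defect v) * v m := by
      simp only [mul_assoc]
    rw [e, hcorner, mul_zero, zero_mul]
  have hsmall : ∀ {c : B}, ρ c = 0 →
      Tendsto (fun M => (c : 𝓜(ℂ, B)) * (1 - star (v M) * v M)) atTop (𝓝 (c : 𝓜(ℂ, B))) := by
    intro c hc
    have h2 : Tendsto (fun M => (c : 𝓜(ℂ, B)) * star (v M) * v M) atTop (𝓝 0) := by
      refine squeeze_zero_norm (fun M => ?_) (tendsto_zero_iff_norm_tendsto_zero.1
        (hρ.tendsto_mul_star hB hπ hc))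
      refine (norm_mul_le _ _).trans ?_
      exact mul_le_of_le_one_right (norm_nonneg _) (hB.relations.norm_le_one M)
    have h3 := h2.const_sub (c : 𝓜(ℂ, B))
    rw [sub_zero] at h3
    refine h3.congr fun M => ?_
    rw [mul_sub, mul_one, mul_assoc]
  have h2 : ∀ N, (1 - star (v N) * v N) * (b : 𝓜(ℂ, B)) = 0 := fun N => by
    refine tendsto_nhds_unique ((hsmall hb).const_mul (1 - star (v N) * v N)) ?_
    simp only [← mul_assoc, h1]
    exact tendsto_const_nhds
  have h3 : ∀ N, ((star b : B) : 𝓜(ℂ, B)) * (1 - star (v N) * v N) = 0 := fun N => by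
    have := congrArg star (h2 N)
    rw [star_mul, star_zero, star_sub, star_mul, star_star, star_one] at this
    rwa [show ((star b : B) : 𝓜(ℂ, B)) = star (b : 𝓜(ℂ, B)) from
      map_star (DoubleCentralizer.coeHom (𝕜 := ℂ) (A := B)) b]
  have h4 : ((star b : B) : 𝓜(ℂ, B)) = 0 := by
    refine tendsto_nhds_unique (hsmall (c := star b) (by rw [map_star, hb, star_zero])) ?_
    simp only [h3]
    exact tendsto_const_nhds
  rw [← norm_eq_zero, ← norm_star, ← norm_coe_multiplier, h4, norm_zero]

end Faithful

/-! ### The hereditary corner j(A)(1 - v_1* v_1), and descent of primitivity. -/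

section Corner

variable {A : Type u} [NonUnitalCStarAlgebra A] {α : A ≃⋆ₐ[ℂ] A} {B : Type u}
  [NonUnitalCStarAlgebra B] {j : A →⋆ₙₐ[ℂ] B} {v : ℕ → 𝓜(ℂ, B)}

/-- A C*-algebra which is isomorphic to a hereditary subalgebra of a primitive C*-algebra is
primitive if it is nonzero. -/
theorem IsPrimitive.of_corner (κ : A →⋆ₙₐ[ℂ] B) (hκ : Function.Injective κ)
    (hc : ∀ a b c, ∃ d, κ a * b * κ c = κ d) (hA : ∃ a : A, a ≠ 0) (hB : IsPrimitive B) :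
    IsPrimitive A := by
  obtain ⟨K, _, _, _, τ, hτ0, hτ, hirr⟩ := hB
  let K₀ : Submodule ℂ K :=
    (Submodule.span ℂ {x : K | ∃ (a : A) (h : K), x = τ (κ a) h}).topologicalClosure
  have hK₀ : IsClosed (K₀ : Set K) := Submodule.isClosed_topologicalClosure _
  have hmem : ∀ a x, τ (κ a) x ∈ K₀ := fun a x =>
    subset_closure (Submodule.subset_span ⟨a, x, rfl⟩)
  have : CompleteSpace K₀ := hK₀.completeSpace_coe
  let σ : A →⋆ₙₐ[ℂ] (K₀ →L[ℂ] K₀) :=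
    { toFun := fun a => ((τ (κ a)).comp K₀.subtypeL).codRestrict K₀ fun x => hmem a x
      map_smul' := fun c a => by ext x; simp; rfl
      map_zero' := by ext x; simp
      map_add' := fun a b => by ext x; simp; rfl
      map_mul' := fun a b => by ext x; simp; rfl
      map_star' := fun a => by
        refine (ContinuousLinearMap.eq_adjoint_iff _ _).2 fun x y => ?_
        change inner ℂ (τ (κ (star a)) (x : K)) (y : K) = inner ℂ (x : K) (τ (κ a) (y : K))
        rw [map_star, map_star, ContinuousLinearMap.star_eq_adjoint,
          ContinuousLinearMap.adjoint_inner_left] }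
  have hσ : ∀ a (x : K₀), (σ a x : K) = τ (κ a) x := fun _ _ => rfl
  have hσinj : Function.Injective σ := by
    refine (injective_iff_map_eq_zero σ).2 fun a ha => ?_
    -- The vanishing of σ(a) says something only on K₀, but τ(κ(a*))x always lies there.
    have h1 : τ (κ (a * star a)) = 0 := by
      ext x
      rw [map_mul, map_mul]
      have := congrArg Subtype.val (DFunLike.congr_fun ha ⟨τ (κ (star a)) x, hmem _ x⟩)
      exact this
    rw [← CStarRing.mul_star_self_eq_zero_iff]
    exact hκ (hτ (by rw [h1, map_zero, map_zero]))
  refine ⟨K₀, inferInstance, inferInstance, inferInstance, σ, fun h => ?_, hσinj, ?_⟩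
  · obtain ⟨a, ha⟩ := hA
    exact ha (hσinj (by rw [h]; rfl))
  · intro S hS hinv
    refine or_iff_not_imp_left.2 fun hne => ?_
    obtain ⟨x, hx, hx0⟩ := Submodule.exists_mem_ne_zero_of_ne_bot hne
    obtain ⟨c, hcx⟩ : ∃ c, τ (κ c) (x : K) ≠ 0 := by
      by_contra! h
      refine hx0 (Subtype.ext ?_)
      -- If all τ(κ(c)) killed x, then x would be orthogonal to K₀, which contains it.
      have h1 : K₀ ≤ (innerSL ℂ (x : K)).ker := by
        refine Submodule.topologicalClosure_minimal _ (Submodule.span_le.2 ?_)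
          (ContinuousLinearMap.isClosed_ker _)
        rintro _ ⟨a, y, rfl⟩
        change inner ℂ (x : K) (τ (κ a) y) = 0
        rw [← ContinuousLinearMap.adjoint_inner_left, ← ContinuousLinearMap.star_eq_adjoint,
          ← map_star, ← map_star, h, inner_zero_left]
      exact inner_self_eq_zero.1 (h1 x.2)
    let S' : Submodule ℂ K := S.map K₀.subtype
    have hS' : IsClosed (S' : Set K) :=
      (hK₀.isClosedEmbedding_subtypeVal.isClosedMap _ hS : IsClosed (Subtype.val '' (S : Set K₀)))
    have hκS : ∀ a y, τ (κ a) y ∈ S' := by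
      intro a y
      -- The vector τ(κ(c))x is cyclic for τ(B), and τ(κ(a))τ(b)τ(κ(c))x = τ(κ(d))x stays in S
      -- because κ(A)Bκ(A) lies in κ(A).
      have h1 : S'.comap (τ (κ a)).toLinearMap = ⊤ := by
        refine hirr.eq_top_of_apply_mem hτ0 hcx (hS'.preimage (τ (κ a)).continuous) fun b => ?_
        obtain ⟨d, hd⟩ := hc a b c
        refine ⟨σ d x, hinv d x hx, ?_⟩
        change τ (κ d) (x : K) = τ (κ a) (τ b (τ (κ c) (x : K)))
        rw [← hd, map_mul, map_mul]
        rfl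
      exact (h1 ▸ Submodule.mem_top : y ∈ S'.comap (τ (κ a)).toLinearMap)
    have hle : K₀ ≤ S' := by
      refine Submodule.topologicalClosure_minimal _ (Submodule.span_le.2 ?_) hS'
      rintro _ ⟨a, y, rfl⟩
      exact hκS a y
    refine eq_top_iff.2 fun y _ => ?_
    obtain ⟨z, hz, hzy⟩ := hle y.2
    rwa [← Subtype.ext hzy]

theorem IsPisoCrossedProduct.coe_cornerElt_zero (hB : IsPisoCrossedProduct α j v) (a : A) :
    ((cornerElt α j v 0 a 0 : B) : 𝓜(ℂ, B)) = multiplierHom j a * defect v := by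
  rw [cornerElt, coe_multiplier_sub, coe_wordElt, coe_wordElt, word, word, hB.v_zero, star_one,
    one_mul, mul_one, zero_add, defect, mul_sub, mul_one, ← mul_assoc, hB.relations.star_comm]
  rfl

/-- The homomorphism `a ↦ j(a) (1 - v_1* v_1)`. -/
noncomputable def cornerHom (hB : IsPisoCrossedProduct α j v) : A →⋆ₙₐ[ℂ] B where
  toFun a := cornerElt α j v 0 a 0
  map_smul' c a := coe_multiplier_injective <| by
    change _ = DoubleCentralizer.coeHom (𝕜 := ℂ) (A := B) (c • cornerElt α j v 0 a 0)
    rw [map_smul]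
    change _ = c • ((cornerElt α j v 0 a 0 : B) : 𝓜(ℂ, B))
    rw [hB.coe_cornerElt_zero, hB.coe_cornerElt_zero, map_smul, smul_mul_assoc]
  map_zero' := coe_multiplier_injective <| by
    change _ = DoubleCentralizer.coeHom (𝕜 := ℂ) (A := B) 0
    rw [map_zero, hB.coe_cornerElt_zero, map_zero, zero_mul]
  map_add' a b := coe_multiplier_injective <| by
    change _ = DoubleCentralizer.coeHom (𝕜 := ℂ) (A := B)
      (cornerElt α j v 0 a 0 + cornerElt α j v 0 b 0)
    rw [map_add]
    change _ = ((cornerElt α j v 0 a 0 : B) : 𝓜(ℂ, B)) + ((cornerElt α j v 0 b 0 : B) : 𝓜(ℂ, B))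
    rw [hB.coe_cornerElt_zero, hB.coe_cornerElt_zero, hB.coe_cornerElt_zero, map_add, add_mul]
  map_mul' a b := coe_multiplier_injective <| by
    change _ = DoubleCentralizer.coeHom (𝕜 := ℂ) (A := B)
      (cornerElt α j v 0 a 0 * cornerElt α j v 0 b 0)
    rw [map_mul]
    change _ = ((cornerElt α j v 0 a 0 : B) : 𝓜(ℂ, B)) * ((cornerElt α j v 0 b 0 : B) : 𝓜(ℂ, B))
    rw [hB.coe_cornerElt_zero, hB.coe_cornerElt_zero, hB.coe_cornerElt_zero, map_mul, mul_assoc,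
      mul_assoc, ← mul_assoc (defect v), hB.relations.defect_comm, mul_assoc _ (defect v),
      hB.relations.defect_mul_self]
  map_star' a := coe_multiplier_injective <| by
    change _ = DoubleCentralizer.coeHom (𝕜 := ℂ) (A := B) (star (cornerElt α j v 0 a 0))
    rw [map_star]
    change _ = star ((cornerElt α j v 0 a 0 : B) : 𝓜(ℂ, B))
    rw [hB.coe_cornerElt_zero, hB.coe_cornerElt_zero, star_mul, star_defect, map_star,
      ← map_star (multiplierHom j), hB.relations.defect_comm]

theorem coe_cornerHom (hB : IsPisoCrossedProduct α j v) (a : A) :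
    ((cornerHom hB a : B) : 𝓜(ℂ, B)) = multiplierHom j a * defect v :=
  hB.coe_cornerElt_zero a

/-- If π(a) ≠ 0 for a nondegenerate π, the integrated form of (Π, V) built from π does not kill
j(a)(1 - v_1* v_1), as its (0, 0) entry is π(a). -/
theorem cornerHom_injective (hB : IsPisoCrossedProduct α j v) :
    Function.Injective (cornerHom hB) := by
  refine (injective_iff_map_eq_zero _).2 fun a ha => ?_
  by_contra hne
  obtain ⟨H, _, _, _, π, hπ, hπa⟩ := exists_isNondegenerateRep_ne_zero hne
  obtain ⟨ρ, hρ⟩ := hB.universal (SqSum H) _ _ (diagRep_isCovariantRep α hπ)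
  exact hπa (hρ.eq_zero_of_cornerElt (by rw [show cornerElt α j v 0 a 0 = 0 from ha, map_zero]))

/-- With d = 1 - v_1* v_1, both d v_n* and v_m d vanish for n, m > 0, so among the words only j(e)
survives, and d commutes with it. The range is closed because an injective homomorphism is
isometric, so density of the words suffices. -/
theorem cornerHom_mul_mul_mem (hB : IsPisoCrossedProduct α j v) (a : A) (b : B) (c : A) :
    ∃ d, cornerHom hB a * b * cornerHom hB c = cornerHom hB d := by
  have hclosed : IsClosed (Set.range (cornerHom hB)) :=
    (NonUnitalStarAlgHom.isometry _ (cornerHom_injective hB)).isClosedEmbedding.isClosed_range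
  have hword : ∀ n e m, ∃ d, cornerHom hB a * wordElt j v n e m * cornerHom hB c =
      cornerHom hB d := by
    intro n e m
    have hcoe : ((cornerHom hB a * wordElt j v n e m * cornerHom hB c : B) : 𝓜(ℂ, B)) =
        multiplierHom j a * (defect v * star (v n)) * multiplierHom j e *
          (multiplierHom j (α^[m] c) * (v m * defect v)) := by
      change DoubleCentralizer.coeHom (𝕜 := ℂ) (A := B) _ = _
      rw [map_mul, map_mul]
      change ((cornerHom hB a : B) : 𝓜(ℂ, B)) * ((wordElt j v n e m : B) : 𝓜(ℂ, B)) *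
        ((cornerHom hB c : B) : 𝓜(ℂ, B)) = _
      rw [coe_cornerHom, coe_cornerHom, coe_wordElt, word, ← mul_assoc (multiplierHom j (α^[m] c)),
        ← hB.relations.comm]
      simp only [mul_assoc]
    rcases n with _ | n
    · rcases m with _ | m
      · refine ⟨a * e * c, coe_multiplier_injective ?_⟩
        have hd := hB.relations.defect_comm
        have e1 : multiplierHom j a * defect v * multiplierHom j e *
            (multiplierHom j c * defect v) =
            multiplierHom j a * (defect v * multiplierHom j e) *
              (multiplierHom j c * defect v) := by
          simp only [mul_assoc]
        have e2 : multiplierHom j a * (multiplierHom j e * defect v) *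
            (multiplierHom j c * defect v) =
            multiplierHom j a * multiplierHom j e * (defect v * multiplierHom j c) *
              defect v := by
          simp only [mul_assoc]
        rw [hcoe, coe_cornerHom, hB.v_zero, star_one, mul_one, one_mul, map_mul, map_mul,
          Function.iterate_zero, id, e1, hd, e2, hd, mul_assoc, mul_assoc _ (defect v),
          hB.relations.defect_mul_self, mul_assoc (_ * _)]
      · refine ⟨0, coe_multiplier_injective ?_⟩
        rw [hcoe, coe_cornerHom, hB.relations.mul_defect, mul_zero, mul_zero, map_zero, zero_mul]
    · refine ⟨0, coe_multiplier_injective ?_⟩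
      rw [hcoe, coe_cornerHom, hB.relations.defect_mul_star, mul_zero, zero_mul, zero_mul,
        map_zero, zero_mul]
  have h := map_mem_closure (f := fun b => cornerHom hB a * b * cornerHom hB c)
    (t := Set.range (cornerHom hB)) (by fun_prop) (hB.dense_span_wordElt b) fun x hx => by
      induction hx using Submodule.span_induction with
      | mem x hx =>
        obtain ⟨n, e, m, rfl⟩ := hx
        obtain ⟨d, hd⟩ := hword n e m
        exact ⟨d, hd.symm⟩
      | zero => exact ⟨0, by simp⟩
      | add x y _ _ hx hy =>
        obtain ⟨d, hd⟩ := hx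
        obtain ⟨e, he⟩ := hy
        exact ⟨d + e, by simp only [map_add, hd, he, mul_add, add_mul]⟩
      | smul k x _ hx =>
        obtain ⟨d, hd⟩ := hx
        exact ⟨k • d, by simp only [map_smul, hd, mul_smul_comm, smul_mul_assoc]⟩
  rw [hclosed.closure_eq] at h
  obtain ⟨d, hd⟩ := h
  exact ⟨d, hd.symm⟩

theorem IsPisoCrossedProduct.isPrimitive_of_isPrimitive (hB : IsPisoCrossedProduct α j v)
    (h : IsPrimitive B) : IsPrimitive A := by
  refine h.of_corner (cornerHom hB) (cornerHom_injective hB) (cornerHom_mul_mul_mem hB) ?_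
  -- If A were 0, nondegeneracy of j would make B zero, and B would have no nonzero representation.
  by_contra! h0
  obtain ⟨K, _, _, _, τ, hτ0, -⟩ := h
  refine hτ0 (NonUnitalStarAlgHom.ext fun b => ?_)
  have h1 : (Submodule.span ℂ {x : B | ∃ (a : A) (b : B), x = j a * b}).topologicalClosure ≤ ⊥ := by
    refine Submodule.topologicalClosure_minimal _ (Submodule.span_le.2 ?_) isClosed_singleton
    rintro _ ⟨a, b, rfl⟩
    rw [h0 a, map_zero, zero_mul]
    rfl
  rw [hB.nondegenerate] at h1
  rw [(Submodule.mem_bot ℂ).1 (h1 (Submodule.mem_top (x := b))), map_zero, map_zero]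

end Corner

end Piso

theorem theorem4p1 {A : Type u} [NonUnitalCStarAlgebra A] (α : A ≃⋆ₐ[ℂ] A)
    {B : Type u} [NonUnitalCStarAlgebra B] (j : A →⋆ₙₐ[ℂ] B) (v : ℕ → 𝓜(ℂ, B))
    (hB : Piso.IsPisoCrossedProduct α j v) :
    (Piso.IsPrimitive B ↔ Piso.IsPrimitive A) ∧
    ∀ (H : Type u) [NormedAddCommGroup H] [InnerProductSpace ℂ H] [CompleteSpace H]
      (π : A →⋆ₙₐ[ℂ] (H →L[ℂ] H)),
      π ≠ 0 → Function.Injective π → Piso.IsIrreducibleRep π →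
        (∃ ρ, Piso.IsIntegratedForm j v (Piso.diagRep α π) (Piso.shiftRep H) ρ) ∧
        ∀ ρ, Piso.IsIntegratedForm j v (Piso.diagRep α π) (Piso.shiftRep H) ρ →
          Piso.IsIrreducibleRep ρ ∧ Function.Injective ρ := by
  have main : ∀ (H : Type u) [NormedAddCommGroup H] [InnerProductSpace ℂ H] [CompleteSpace H]
      (π : A →⋆ₙₐ[ℂ] (H →L[ℂ] H)),
      π ≠ 0 → Function.Injective π → Piso.IsIrreducibleRep π →
        (∃ ρ, Piso.IsIntegratedForm j v (Piso.diagRep α π) (Piso.shiftRep H) ρ) ∧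
        ∀ ρ, Piso.IsIntegratedForm j v (Piso.diagRep α π) (Piso.shiftRep H) ρ →
          Piso.IsIrreducibleRep ρ ∧ Function.Injective ρ := fun H _ _ _ π h0 hinj hirr =>
    ⟨hB.universal _ _ _ (Piso.diagRep_isCovariantRep α (hirr.isNondegenerateRep h0)),
      fun ρ hρ => ⟨hρ.isIrreducibleRep h0 hirr, hρ.injective hB hinj⟩⟩
  refine ⟨⟨hB.isPrimitive_of_isPrimitive, ?_⟩, main⟩
  rintro ⟨H, _, _, _, π, h0, hinj, hirr⟩
  obtain ⟨⟨ρ, hρ⟩, h⟩ := main H π h0 hinj hirr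
  refine ⟨Piso.SqSum H, inferInstance, inferInstance, inferInstance, ρ, fun hρ0 => h0 ?_,
    (h ρ hρ).2, (h ρ hρ).1⟩
  -- ρ is nonzero because its corners recover every π(a).
  exact NonUnitalStarAlgHom.ext fun a => hρ.eq_zero_of_cornerElt (by rw [hρ0]; rfl)
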